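/- For integers $m\ge n\ge 1$ let $A=A_{m,n}$ be a random real $m\times n$ matrix whose entries are i.i.d. standard Cauchy random variables (density $\frac1{\pi(1+x^2)}$), let $\lambda_1,\dots,\lambda_n$ be the eigenvalues of $A^tA$ with multiplicity, and put $\tilde\lambda_i=\lambda_i/(m^2n^2)$. Let $D=\{z\in\mathbb C:\Re z>0\}$, let $\sqrt z$ be the branch on $D$ with $\sqrt1=1$, let $w^{-1/2}$ for $w\in D$ be $1/\sqrt w$, and let $\det\bigl(1+\frac{z}{m^2n^2}A^tA\bigr)^{-1/2}$, $z\in D$, denote the holomorphic branch that is positive for real $z>0$. Then: (i) For all $m\ge n\ge 1$ and $z\in D$ the following expectations exist and are equal: $$E\det\Bigl(1+\frac{z}{m^2n^2}A^tA\Bigr)^{-1/2}=E\prod_{i=1}^n(1+z\tilde\lambda_i)^{-1/2}.$$ (ii) As $n\to\infty$, uniformly in $m\ge n$ and uniformly for $z$ in compact subsets of $D$, $$E\det\Bigl(1+\frac{z}{m^2n^2}A^tA\Bigr)^{-1/2}\longrightarrow\exp\Bigl(-\frac2\pi\sqrt z\Bigr).$$ (iii) Let $\{x_i\}$ be the points of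 a Poisson point process on $(0,\infty)$ with intensity $\frac{1}{\pi x^{3/2}}$, and let $\mathbf E$ be the corresponding expectation. For every $z\in D$ the product $\prod_i(1+zx_i)^{-1/2}$ converges unconditionally almost surely, is integrable, and $$\exp\Bigl(-\frac2\pi\sqrt z\Bigr)=\mathbf E\prod_{i=1}^\infty(1+zx_i)^{-1/2}.$$ (iv) There are real numbers $r_{m,n}(t)$ such that for all $m\ge n\ge1$ and all $t\in\mathbb R$ $$E\det\Bigl(1+\frac{t^2}{m^2n^2}A^tA\Bigr)^{-1/2}=E\prod_{i=1}^n(1+t^2\tilde\lambda_i)^{-1/2}=\exp\Bigl(-\frac2\pi|t|\,\bigl(1+r_{m,n}(t)\bigr)\Bigr),$$ and for every $\varepsilon>0$, $r_{m,n}(t)=o(n^{-1/2+\varepsilon})$ as $n\to\infty$, uniformly in $m\ge n$ and uniformly for $t$ in compact subsets of $\mathbb R$. -/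

import Mathlib

open MeasureTheory ProbabilityTheory Matrix

/-- A random real `m × n` matrix whose entries are independent standard Cauchy random variables,
i.e. with density `1 / (π (1 + x ^ 2))`. -/
structure IsCauchyMatrix {Ω : Type*} [MeasurableSpace Ω] (P : Measure Ω) {m n : ℕ}
    (A : Ω → Matrix (Fin m) (Fin n) ℝ) : Prop where
  hasLaw_entry : ∀ i j, HasLaw (fun ω => A ω i j) (cauchyMeasure 0 1) P
  indep : iIndepFun (fun (p : Fin m × Fin n) ω => A ω p.1 p.2) P

/-- The rescaled matrix `(m² n²)⁻¹ Aᵗ A`. -/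
noncomputable def scaledGram {m n : ℕ} (A : Matrix (Fin m) (Fin n) ℝ) :
    Matrix (Fin n) (Fin n) ℝ :=
  (1 / ((m : ℝ) ^ 2 * (n : ℝ) ^ 2)) • (Aᵀ * A)

theorem gram_posSemidef {m n : ℕ} (A : Matrix (Fin m) (Fin n) ℝ) : (Aᵀ * A).PosSemidef := by
  simpa using Matrix.posSemidef_conjTranspose_mul_self A

theorem scaledGram_posSemidef {m n : ℕ} (A : Matrix (Fin m) (Fin n) ℝ) :
    (scaledGram A).PosSemidef :=
  (gram_posSemidef A).smul (by positivity)

/-- The rescaled eigenvalues `λᵢ / (m² n²)`, where the `λᵢ` are the eigenvalues of `Aᵗ A`,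
listed with multiplicity. -/
noncomputable def rescaledEigenvalue {m n : ℕ} (A : Matrix (Fin m) (Fin n) ℝ) (i : Fin n) : ℝ :=
  (gram_posSemidef A).isHermitian.eigenvalues i / ((m : ℝ) ^ 2 * (n : ℝ) ^ 2)

/-- `f` is, on the right half-plane, the holomorphic branch of `z ↦ det (1 + z M) ^ (-1/2)`
that is the positive square root for positive real `z`. By the identity theorem there is
at most one such function on the half-plane. -/
structure IsDetInvSqrt {n : ℕ} (M : Matrix (Fin n) (Fin n) ℝ) (f : ℂ → ℂ) : Prop where
  holo : DifferentiableOn ℂ f {z | 0 < z.re}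
  sq : ∀ z : ℂ, 0 < z.re → f z ^ 2 * (1 + z • M.map (fun x : ℝ => (x : ℂ))).det = 1
  pos : ∀ x : ℝ, 0 < x → f x = (((1 + x • M).det ^ (-(1 / 2) : ℝ) : ℝ) : ℂ)

theorem det_one_add_smul_map {n : ℕ} {M : Matrix (Fin n) (Fin n) ℝ} (hM : M.IsHermitian)
    {z : ℂ} (hz : z ≠ 0) :
    (1 + z • M.map (fun x : ℝ => (x : ℂ))).det = ∏ i, (1 + z * (hM.eigenvalues i : ℂ)) := by
  have h1 : (M.map (Complex.ofRealHom)).charpoly = M.charpoly.map Complex.ofRealHom :=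
    Matrix.charpoly_map M Complex.ofRealHom
  have h2 := congrArg (Polynomial.eval (-z⁻¹)) h1
  rw [Matrix.eval_charpoly, hM.charpoly_eq, Polynomial.map_prod, Polynomial.eval_prod] at h2
  have h3 : (1 + z • M.map (fun x : ℝ => (x : ℂ)))
      = (-z) • (Matrix.scalar (Fin n) (-z⁻¹) - M.map Complex.ofRealHom) := by
    ext i j
    by_cases hij : i = j
    · subst hij
      simp
      field_simp
      ring
    · simp [hij]
  rw [h3, Matrix.det_smul, h2, Fintype.card, ← Finset.prod_const, ← Finset.prod_mul_distrib]
  refine Finset.prod_congr rfl fun i _ => ?_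
  simp
  field_simp
  ring

theorem exists_isDetInvSqrt {n : ℕ} {M : Matrix (Fin n) (Fin n) ℝ} (hM : M.PosSemidef) :
    ∃ f : ℂ → ℂ, IsDetInvSqrt M f := by
  have hpos : ∀ z : ℂ, 0 < z.re → ∀ i,
      0 < (1 + z * (hM.isHermitian.eigenvalues i : ℂ)).re := by
    intro z hz i
    have := hM.eigenvalues_nonneg i
    simp
    positivity
  refine ⟨fun z => ∏ i, (1 + z * (hM.isHermitian.eigenvalues i : ℂ)) ^ (-(1 / 2) : ℂ),
    ?_, ?_, ?_⟩
  · refine DifferentiableOn.fun_finsetProd fun i _ => ?_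
    refine DifferentiableOn.cpow_const (by fun_prop) fun z hz => ?_
    exact Or.inl (hpos z hz i)
  · intro z hz
    have hz0 : z ≠ 0 := by rintro rfl; simp at hz
    rw [det_one_add_smul_map hM.isHermitian hz0, ← Finset.prod_pow, ← Finset.prod_mul_distrib]
    refine Finset.prod_eq_one fun i _ => ?_
    have h0 : (1 + z * (hM.isHermitian.eigenvalues i : ℂ)) ≠ 0 := by
      intro h
      have := hpos z hz i
      rw [h] at this
      simp at this
    rw [← Complex.cpow_nat_mul]
    have : ((2 : ℕ) : ℂ) * (-(1 / 2)) = -1 := by push_cast; ring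
    rw [this, Complex.cpow_neg_one, inv_mul_cancel₀ h0]
  · intro x hx
    have hx0 : (x : ℂ) ≠ 0 := by exact_mod_cast hx.ne'
    have h1 := det_one_add_smul_map hM.isHermitian hx0
    have h2 : (1 + (x : ℂ) • M.map (fun x : ℝ => (x : ℂ)))
        = (1 + x • M).map Complex.ofRealHom := by
      ext i j
      by_cases hij : i = j
      · subst hij; simp
      · simp [hij]
    have h3 : ((1 + x • M).map Complex.ofRealHom).det = ((1 + x • M).det : ℂ) :=
      (RingHom.map_det Complex.ofRealHom (1 + x • M)).symm
    rw [h2, h3] at h1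
    have h4 : (1 + x • M).det = ∏ i, (1 + x * hM.isHermitian.eigenvalues i) := by
      exact_mod_cast h1
    have hnn : ∀ i, 0 ≤ 1 + x * hM.isHermitian.eigenvalues i := by
      intro i
      have := hM.eigenvalues_nonneg i
      positivity
    rw [h4, ← Real.finsetProd_rpow _ _ (fun i _ => hnn i)]
    push_cast
    refine Finset.prod_congr rfl fun i _ => ?_
    rw [Complex.ofReal_cpow (hnn i)]
    push_cast
    rfl

/-- `det (1 + z (m² n²)⁻¹ Aᵗ A) ^ (-1/2)` for `z` in the right half-plane: the holomorphic branch
that is positive for positive real `z`. -/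
noncomputable def detInvSqrt {m n : ℕ} (A : Matrix (Fin m) (Fin n) ℝ) : ℂ → ℂ :=
  Classical.choose (exists_isDetInvSqrt (scaledGram_posSemidef A))

/-- `X` is a Poisson point process on `S` with intensity measure `ν`: a random countable set such
that the number of its points in a measurable set `B` is a random variable, which is Poisson
distributed with parameter `ν B` (almost surely infinite if `ν B = ∞`), and such that the numbers
of points in disjoint measurable sets are independent. -/
structure IsPoissonPointProcess {S Ω : Type*} [MeasurableSpace S] [MeasurableSpace Ω]
    (ν : Measure S) (P : Measure Ω) (X : Ω → Set S) : Prop where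
  countable : ∀ ω, (X ω).Countable
  measurable_count : ∀ B, MeasurableSet B → Measurable (fun ω => (X ω ∩ B).encard)
  hasLaw_count : ∀ B, MeasurableSet B → ν B ≠ ⊤ →
    HasLaw (fun ω => (X ω ∩ B).encard)
      ((poissonMeasure (ν B).toNNReal).map (fun k : ℕ => (k : ℕ∞))) P
  count_eq_top : ∀ B, MeasurableSet B → ν B = ⊤ → ∀ᵐ ω ∂P, (X ω ∩ B).encard = ⊤
  indep : ∀ (k : ℕ) (B : Fin k → Set S), (∀ i, MeasurableSet (B i)) →
    Pairwise (fun i j => Disjoint (B i) (B j)) →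
    iIndepFun (fun i ω => (X ω ∩ B i).encard) P

/-- The measure with density `1 / (π x ^ (3/2))` on the positive half-axis `(0, ∞)`. -/
noncomputable def cauchyIntensity : Measure ℝ :=
  (volume.restrict (Set.Ioi (0 : ℝ))).withDensity
    (fun x => ENNReal.ofReal (1 / (Real.pi * x ^ (3 / 2 : ℝ))))

/-! The determinant is a Gaussian integral, and a second Gaussian integral makes it linear in the
matrix. For a standard Gaussian vector `g`, the power `det (1 + z M) ^ (-1/2)` is the mean of `exp
(-(z/2) ⟨g, M g⟩)`. When `z = t²` and `M = AᵗA / (m² n²)`, this exponential is in turn the mean of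
`exp (i s ⟨h, A g⟩)` with `s = t / (m n)` and `h` an independent Gaussian vector. The entries of `A`
now enter linearly, so they can be integrated out first. Since the Cauchy characteristic function is
`exp (-|u|)`, the result is `E exp (-t Y)`, where `Y` is the mean of the `|gⱼ|` times the mean of
the `|hᵢ|` (`complexMGF_scaledQuadratic_sq`). Both sides are holomorphic in `z = t²`, so the
identity extends to the right half-plane (`integral_eigenvalueProd_eq`).

The two means concentrate at `√(2/π)`, hence `Y` at `2/π`: a variance bound gives `E |Y - 2/π| ≤
2/√n` for `m ≥ n`. As `exp` is 1-Lipschitz on the left half-plane, `E exp (-w Y)` differs from `exp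
(-2w/π)` by at most `2|w|/√n`, which is the locally uniform limit. For real `t`, Jensen's inequality
supplies the matching lower bound, and taking logarithms turns the estimate into a relative error of
order `n^(-1/2)` in the exponent (`abs_exponentError_le`).

The Poisson side is independent of this. The product is the exponential of the sum of `-(1/2) log (1
+ z x)` over the points, and the Laplace functional (`IsPoissonPointProcess.integral_cexp_integral`)
reduces its mean to `∫ ((1 + z x)^(-1/2) - 1) dx / (π x^(3/2))`, which an explicit antiderivative
evaluates to `-(2/π) √z`. -/

/-! ### Holomorphic branch and eigenvalue product -/

/-- Holomorphic functions on the right half-plane are determined by their values on the positive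
half-axis. -/
theorem eqOn_re_pos_of_eq_ofReal {f g : ℂ → ℂ} (hf : DifferentiableOn ℂ f {z | 0 < z.re})
    (hg : DifferentiableOn ℂ g {z | 0 < z.re}) (h : ∀ x : ℝ, 0 < x → f x = g x) :
    Set.EqOn f g {z | 0 < z.re} := by
  have ho : IsOpen {z : ℂ | 0 < z.re} := isOpen_lt continuous_const Complex.continuous_re
  refine (hf.analyticOnNhd ho).eqOn_of_preconnected_of_frequently_eq (hg.analyticOnNhd ho)
    (convex_halfSpace_re_gt 0).isPreconnected (z₀ := 1) (by simp) ?_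
  -- The points `1 + 1/(k+1)` lie on the positive axis and accumulate at `1` without reaching it, as
  -- the identity theorem requires.
  have ht : Filter.Tendsto (fun k : ℕ => ((1 + 1 / ((k : ℝ) + 1) : ℝ) : ℂ)) Filter.atTop
      (nhdsWithin 1 {1}ᶜ) := by
    refine tendsto_nhdsWithin_iff.2 ⟨?_, Filter.Eventually.of_forall fun k => ?_⟩
    · have := (tendsto_one_div_add_atTop_nhds_zero_nat (𝕜 := ℝ)).const_add 1
      have := (Complex.continuous_ofReal.tendsto _).comp this
      simpa [Function.comp_def] using this
    · have h1 : (1 + 1 / ((k : ℝ) + 1)) ≠ 1 := by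
        have : (0 : ℝ) < 1 / ((k : ℝ) + 1) := by positivity
        linarith
      exact fun h => h1 (Complex.ofReal_injective (by simpa using h))
  refine ht.frequently (Filter.Frequently.of_forall fun k => h _ (by positivity))

theorem rescaledEigenvalue_nonneg {m n : ℕ} (A : Matrix (Fin m) (Fin n) ℝ) (i : Fin n) :
    0 ≤ rescaledEigenvalue A i :=
  div_nonneg ((gram_posSemidef A).eigenvalues_nonneg i) (by positivity)

theorem det_one_add_smul_scaledGram {m n : ℕ} (hm : m ≠ 0) (hn : n ≠ 0)
    (A : Matrix (Fin m) (Fin n) ℝ) (x : ℝ) :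
    (1 + x • scaledGram A).det = ∏ i, (1 + x * rescaledEigenvalue A i) := by
  rcases eq_or_ne x 0 with rfl | hx
  · simp
  have hm' : (m : ℝ) ≠ 0 := by exact_mod_cast hm
  have hn' : (n : ℝ) ≠ 0 := by exact_mod_cast hn
  set y : ℝ := x / ((m : ℝ) ^ 2 * (n : ℝ) ^ 2) with hy
  have hy0 : (y : ℂ) ≠ 0 := by
    have : y ≠ 0 := by positivity
    exact_mod_cast this
  have h1 := det_one_add_smul_map (gram_posSemidef A).isHermitian hy0
  have h2 : (1 + (y : ℂ) • (Aᵀ * A).map (fun x : ℝ => (x : ℂ)))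
      = (1 + x • scaledGram A).map Complex.ofRealHom := by
    ext i j
    by_cases hij : i = j
    · subst hij
      simp [scaledGram, hy]
      ring
    · simp [hij, scaledGram, hy]
      ring
  have h3 : ((1 + x • scaledGram A).map Complex.ofRealHom).det = ((1 + x • scaledGram A).det : ℂ) :=
    (RingHom.map_det Complex.ofRealHom _).symm
  rw [h2, h3] at h1
  have h4 : (1 + x • scaledGram A).det
      = ∏ i, (1 + y * (gram_posSemidef A).isHermitian.eigenvalues i) := by
    exact_mod_cast h1
  rw [h4]
  refine Finset.prod_congr rfl fun i _ => ?_
  rw [hy, rescaledEigenvalue]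
  ring

theorem det_rpow_eq_prod {m n : ℕ} (hm : m ≠ 0) (hn : n ≠ 0)
    (A : Matrix (Fin m) (Fin n) ℝ) {x : ℝ} (hx : 0 ≤ x) :
    (1 + x • scaledGram A).det ^ (-(1 / 2) : ℝ)
      = ∏ i, (1 + x * rescaledEigenvalue A i) ^ (-(1 / 2) : ℝ) := by
  have h (i) := rescaledEigenvalue_nonneg A i
  rw [det_one_add_smul_scaledGram hm hn, Real.finsetProd_rpow]
  intro i _
  have := h i
  positivity

theorem ofReal_prod_rescaledEigenvalue {m n : ℕ} (A : Matrix (Fin m) (Fin n) ℝ) {x : ℝ}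
    (hx : 0 ≤ x) :
    ((∏ i, (1 + x * rescaledEigenvalue A i) ^ (-(1 / 2) : ℝ) : ℝ) : ℂ)
      = ∏ i, (1 + (x : ℂ) * (rescaledEigenvalue A i : ℂ)) ^ (-(1 / 2) : ℂ) := by
  have h (i) := rescaledEigenvalue_nonneg A i
  push_cast
  refine Finset.prod_congr rfl fun i _ => ?_
  have := h i
  rw [Complex.ofReal_cpow (by positivity)]
  push_cast
  rfl

theorem one_add_mul_re_pos {z : ℂ} (hz : 0 ≤ z.re) {l : ℝ} (hl : 0 ≤ l) :
    0 < (1 + z * (l : ℂ)).re := by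
  simp
  positivity

/-- Each factor `1 + z λ` stays in the right half-plane, so the product of principal powers is
holomorphic; it agrees with the chosen branch on the positive axis. -/
theorem detInvSqrt_eq_prod {m n : ℕ} (hm : m ≠ 0) (hn : n ≠ 0)
    (A : Matrix (Fin m) (Fin n) ℝ) {z : ℂ} (hz : 0 < z.re) :
    detInvSqrt A z = ∏ i, (1 + z * (rescaledEigenvalue A i : ℂ)) ^ (-(1 / 2) : ℂ) := by
  have hs := Classical.choose_spec (exists_isDetInvSqrt (scaledGram_posSemidef A))
  refine eqOn_re_pos_of_eq_ofReal (f := detInvSqrt A)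
    (g := fun z => ∏ i, (1 + z * (rescaledEigenvalue A i : ℂ)) ^ (-(1 / 2) : ℂ)) hs.holo ?_ ?_ hz
  · refine DifferentiableOn.fun_finsetProd fun i _ => ?_
    refine DifferentiableOn.cpow_const (by fun_prop) fun z hz => ?_
    exact Or.inl (one_add_mul_re_pos (le_of_lt hz) (rescaledEigenvalue_nonneg A i))
  · intro x hx
    rw [detInvSqrt, hs.pos x hx, det_rpow_eq_prod hm hn A hx.le,
      ofReal_prod_rescaledEigenvalue A hx.le]

/-! ### Gaussian representation of the determinant -/

theorem ofReal_mul_cpow {x : ℝ} (hx : 0 < x) (w a : ℂ) :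
    ((x : ℂ) * w) ^ a = (x : ℂ) ^ a * w ^ a := by
  have hx' : (x : ℂ) ≠ 0 := by exact_mod_cast hx.ne'
  rcases eq_or_ne a 0 with rfl | ha
  · simp
  rcases eq_or_ne w 0 with rfl | hw
  · simp [ha]
  rw [Complex.cpow_def_of_ne_zero (mul_ne_zero hx' hw), Complex.cpow_def_of_ne_zero hx',
    Complex.cpow_def_of_ne_zero hw, Complex.log_ofReal_mul hx hw, ← Complex.exp_add,
    Complex.ofReal_log hx.le]
  ring_nf

theorem integral_cexp_neg_sq_gaussianReal {w : ℂ} (hw : 0 ≤ w.re) :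
    ∫ x : ℝ, Complex.exp (-(w / 2) * (x : ℂ) ^ 2) ∂(gaussianReal 0 1)
      = (1 + w) ^ (-(1 / 2) : ℂ) := by
  have h1 : 0 < ((1 + w) / 2).re := by simp; linarith
  have h2 : 0 < (1 + w).re := by simp; linarith
  have h20 : (1 + w) ≠ 0 := by rintro h; simp [h] at h2
  rw [integral_gaussianReal_eq_integral_smul one_ne_zero]
  have h3 : ∀ x : ℝ, gaussianPDFReal 0 1 x • Complex.exp (-(w / 2) * (x : ℂ) ^ 2)
      = ((Real.sqrt (2 * Real.pi))⁻¹ : ℂ) * Complex.exp (-((1 + w) / 2) * (x : ℂ) ^ 2) := by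
    intro x
    simp only [gaussianPDFReal, Complex.real_smul]
    push_cast
    rw [mul_assoc, ← Complex.exp_add]
    congr 2
    · simp
    · simp; ring
  simp_rw [h3]
  rw [integral_const_mul, integral_gaussian_complex h1]
  have h4 : (Real.pi : ℂ) / ((1 + w) / 2) = ((2 * Real.pi : ℝ) : ℂ) * (1 + w)⁻¹ := by
    push_cast
    field_simp
  have hs : ((2 * Real.pi : ℝ) : ℂ) ^ (1 / 2 : ℂ) = (Real.sqrt (2 * Real.pi) : ℂ) := by
    rw [Real.sqrt_eq_rpow, Complex.ofReal_cpow (by positivity)]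
    norm_num
  have hpi : (Real.sqrt (2 * Real.pi) : ℂ) ≠ 0 := by
    have : Real.sqrt (2 * Real.pi) ≠ 0 := by positivity
    exact_mod_cast this
  have harg : (1 + w).arg ≠ Real.pi := by
    intro h
    have := Complex.arg_eq_pi_iff.1 h
    linarith [this.1]
  rw [h4, ofReal_mul_cpow (by positivity), hs, Complex.inv_cpow _ _ harg, Complex.cpow_neg]
  field_simp

/-- The standard Gaussian measure on `ℝⁿ`. -/
noncomputable abbrev gaussianPi (n : ℕ) : Measure (Fin n → ℝ) :=
  Measure.pi fun _ => gaussianReal 0 1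

theorem dotProduct_mulVec_eq_sum_eigenvalues {n : ℕ} {M : Matrix (Fin n) (Fin n) ℝ}
    (hM : M.IsHermitian) (x : Fin n → ℝ) :
    (∑ i, x i • hM.eigenvectorBasis i : EuclideanSpace ℝ (Fin n)).ofLp ⬝ᵥ
      (M *ᵥ (∑ i, x i • hM.eigenvectorBasis i : EuclideanSpace ℝ (Fin n)).ofLp)
      = ∑ i, hM.eigenvalues i * x i ^ 2 := by
  set v : EuclideanSpace ℝ (Fin n) := ∑ i, x i • hM.eigenvectorBasis i with hv
  have h1 : WithLp.toLp 2 (M *ᵥ v.ofLp)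
      = ∑ i, (hM.eigenvalues i * x i) • hM.eigenvectorBasis i := by
    apply WithLp.ofLp_injective
    simp only [hv, WithLp.ofLp_sum, WithLp.ofLp_smul]
    rw [Matrix.mulVec_sum]
    refine Finset.sum_congr rfl fun i _ => ?_
    rw [Matrix.mulVec_smul, hM.mulVec_eigenvectorBasis, smul_smul, mul_comm]
  have h2 : v.ofLp ⬝ᵥ (M *ᵥ v.ofLp) = inner ℝ (WithLp.toLp 2 (M *ᵥ v.ofLp)) v := by
    simp [EuclideanSpace.inner_eq_star_dotProduct]
  rw [h2, h1, hv, hM.eigenvectorBasis.orthonormal.inner_sum]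
  refine Finset.sum_congr rfl fun i _ => ?_
  simp
  ring

/-- Rotation invariance: the coordinates of a standard Gaussian vector in the eigenbasis are again
independent standard Gaussians. -/
theorem integral_gaussianPi_eigenbasis {n : ℕ} {M : Matrix (Fin n) (Fin n) ℝ}
    (hM : M.IsHermitian) {f : ℝ → ℂ} (hf : Continuous f) :
    ∫ g, f (g ⬝ᵥ (M *ᵥ g)) ∂(gaussianPi n)
      = ∫ x, f (∑ i, hM.eigenvalues i * x i ^ 2) ∂(gaussianPi n) := by
  have hc : Continuous fun v : EuclideanSpace ℝ (Fin n) => f (v.ofLp ⬝ᵥ (M *ᵥ v.ofLp)) := by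
    refine hf.comp ?_
    fun_prop
  have h1 : ∫ v, f (v.ofLp ⬝ᵥ (M *ᵥ v.ofLp)) ∂(stdGaussian (EuclideanSpace ℝ (Fin n)))
      = ∫ g, f (g ⬝ᵥ (M *ᵥ g)) ∂(gaussianPi n) := by
    rw [← map_pi_eq_stdGaussian, integral_map (by fun_prop) hc.aestronglyMeasurable]
  rw [← h1, stdGaussian_eq_map_pi_orthonormalBasis hM.eigenvectorBasis,
    integral_map (Measurable.aemeasurable (by fun_prop)) hc.aestronglyMeasurable]
  simp_rw [dotProduct_mulVec_eq_sum_eigenvalues hM]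

/-- The Gaussian representation of `det (1 + z M) ^ (-1/2)` in terms of eigenvalues. -/
theorem integral_cexp_quadratic_gaussianPi {n : ℕ} {M : Matrix (Fin n) (Fin n) ℝ}
    (hM : M.PosSemidef) {z : ℂ} (hz : 0 ≤ z.re) :
    ∫ g, Complex.exp (-(z / 2) * ((g ⬝ᵥ (M *ᵥ g) : ℝ) : ℂ)) ∂(gaussianPi n)
      = ∏ i, (1 + z * (hM.isHermitian.eigenvalues i : ℂ)) ^ (-(1 / 2) : ℂ) := by
  rw [integral_gaussianPi_eigenbasis hM.isHermitian (f := fun s : ℝ => Complex.exp (-(z / 2) * s))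
    (by fun_prop)]
  have h : ∀ x : Fin n → ℝ,
      Complex.exp (-(z / 2) * ((∑ i, hM.isHermitian.eigenvalues i * x i ^ 2 : ℝ) : ℂ))
      = ∏ i, Complex.exp (-(z * (hM.isHermitian.eigenvalues i : ℂ) / 2) * (x i : ℂ) ^ 2) := by
    intro x
    rw [← Complex.exp_sum]
    push_cast
    rw [Finset.mul_sum]
    congr 1
    refine Finset.sum_congr rfl fun i _ => ?_
    ring
  simp_rw [h]
  rw [integral_fintype_prod_eq_prod (f := fun (i : Fin n) (y : ℝ) =>
    Complex.exp (-(z * (hM.isHermitian.eigenvalues i : ℂ) / 2) * (y : ℂ) ^ 2))]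
  refine Finset.prod_congr rfl fun i _ => integral_cexp_neg_sq_gaussianReal ?_
  have := hM.eigenvalues_nonneg i
  simp
  positivity

theorem dotProduct_gram_mulVec {m n : ℕ} (A : Matrix (Fin m) (Fin n) ℝ) (g : Fin n → ℝ) :
    g ⬝ᵥ ((Aᵀ * A) *ᵥ g) = (A *ᵥ g) ⬝ᵥ (A *ᵥ g) := by
  rw [← Matrix.mulVec_mulVec, Matrix.dotProduct_mulVec, Matrix.vecMul_transpose]

theorem prod_rescaledEigenvalue_eq_integral {m n : ℕ}
    (A : Matrix (Fin m) (Fin n) ℝ) {z : ℂ} (hz : 0 ≤ z.re) :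
    ∏ i, (1 + z * (rescaledEigenvalue A i : ℂ)) ^ (-(1 / 2) : ℂ)
      = ∫ g, Complex.exp (-z *
        (((A *ᵥ g) ⬝ᵥ (A *ᵥ g) / (2 * ((m : ℝ) ^ 2 * (n : ℝ) ^ 2)) : ℝ) : ℂ)) ∂(gaussianPi n) := by
  set c : ℝ := (m : ℝ) ^ 2 * (n : ℝ) ^ 2 with hc
  have h := integral_cexp_quadratic_gaussianPi (gram_posSemidef A) (z := z * ((1 / c : ℝ) : ℂ))
    (by rw [Complex.re_mul_ofReal]; positivity)
  calc _ = _ := Finset.prod_congr rfl fun i _ => by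
        rw [rescaledEigenvalue, ← hc]; push_cast; ring_nf
    _ = _ := h.symm
    _ = _ := by
      refine integral_congr_ae (Filter.Eventually.of_forall fun g => ?_)
      simp only [dotProduct_gram_mulVec]
      push_cast
      ring_nf

/-! ### Characteristic function of the Cauchy law -/

theorem integral_cexp_mul_exp_neg_abs (ξ : ℝ) :
    Integrable (fun v : ℝ => Complex.exp (-(2 * Real.pi * v * ξ * Complex.I) -
      2 * Real.pi * |v|)) ∧
    ∫ v : ℝ, Complex.exp (-(2 * Real.pi * v * ξ * Complex.I) - 2 * Real.pi * |v|)
      = ((Real.pi⁻¹ * (1 + ξ ^ 2)⁻¹ : ℝ) : ℂ) := by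
  set a : ℂ := -(2 * Real.pi * (1 + ξ * Complex.I)) with ha
  set b : ℂ := 2 * Real.pi * (1 - ξ * Complex.I) with hb
  have har : a.re < 0 := by simp [ha, Real.pi_pos]
  have hbr : 0 < b.re := by simp [hb, Real.pi_pos]
  have h1 : ∀ v ∈ Set.Ioi (0 : ℝ), Complex.exp (a * v)
      = Complex.exp (-(2 * Real.pi * v * ξ * Complex.I) - 2 * Real.pi * |v|) := by
    intro v hv
    rw [abs_of_pos hv, ha]
    ring_nf
  have h2 : ∀ v ∈ Set.Iic (0 : ℝ), Complex.exp (b * v)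
      = Complex.exp (-(2 * Real.pi * v * ξ * Complex.I) - 2 * Real.pi * |v|) := by
    intro v hv
    rw [abs_of_nonpos hv, hb]
    push_cast
    ring_nf
  have i1 := (integrableOn_exp_mul_complex_Ioi har 0).congr_fun h1 measurableSet_Ioi
  have i2 := (integrableOn_exp_mul_complex_Iic hbr 0).congr_fun h2 measurableSet_Iic
  have hu : Set.Iic (0 : ℝ) ∪ Set.Ioi 0 = Set.univ := Set.Iic_union_Ioi
  refine ⟨by rw [← integrableOn_univ, ← hu]; exact i2.union i1, ?_⟩
  rw [← setIntegral_univ, ← hu, setIntegral_union (Set.Iic_disjoint_Ioi le_rfl) measurableSet_Ioi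
    i2 i1, ← setIntegral_congr_fun measurableSet_Ioi h1, ← setIntegral_congr_fun measurableSet_Iic h2,
    integral_exp_mul_complex_Ioi har, integral_exp_mul_complex_Iic hbr]
  have ha0 : (1 + ξ * Complex.I : ℂ) ≠ 0 := by
    intro h; have := congrArg Complex.re h; simp at this
  have hb0 : (1 - ξ * Complex.I : ℂ) ≠ 0 := by
    intro h; have := congrArg Complex.re h; simp at this
  have hp : (Real.pi : ℂ) ≠ 0 := by exact_mod_cast Real.pi_ne_zero
  have hx : (1 + (ξ : ℂ) ^ 2) ≠ 0 := by
    have : (1 + ξ ^ 2) ≠ 0 := by positivity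
    exact_mod_cast this
  have hfac : (1 + ξ * Complex.I : ℂ) * (1 - ξ * Complex.I) = 1 + (ξ : ℂ) ^ 2 := by
    ring_nf; simp
  rw [ha, hb]
  push_cast
  rw [← hfac]
  simp only [mul_zero, Complex.exp_zero]
  field_simp
  ring

/-- The characteristic function of the standard Cauchy distribution. -/
theorem charFun_cauchyMeasure (t : ℝ) :
    charFun (cauchyMeasure 0 1) t = (Real.exp (-|t|) : ℂ) := by
  set f : ℝ → ℂ := fun v => Complex.exp (-(2 * Real.pi * |v|)) with hf
  -- The Cauchy density is the Fourier transform of `exp (-2π|v|)`; inversion at `t / (2π)` then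
  -- gives the characteristic function at `t`.
  have hF : FourierTransform.fourier f = fun ξ : ℝ => (cauchyPDFReal 0 1 ξ : ℂ) := by
    ext ξ
    rw [Real.fourier_real_eq_integral_exp_smul]
    have := (integral_cexp_mul_exp_neg_abs ξ).2
    rw [cauchyPDFReal_def]
    convert this using 1
    · refine integral_congr_ae (Filter.Eventually.of_forall fun v => ?_)
      simp only [hf, smul_eq_mul]
      rw [← Complex.exp_add]
      push_cast
      ring_nf
    · simp [add_comm]
  have hfi : Integrable f := by
    simpa [hf] using (integral_cexp_mul_exp_neg_abs 0).1
  have hinv : FourierTransformInv.fourierInv (FourierTransform.fourier f) = f := by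
    refine Continuous.fourierInv_fourier_eq (by fun_prop) hfi ?_
    rw [hF]
    exact (integrable_cauchyPDFReal 0).ofReal
  have h := congrFun hinv (t / (2 * Real.pi))
  rw [hF, Real.fourierInv_eq'] at h
  rw [charFun_apply_real, cauchyMeasure_of_scale_ne_zero 0 one_ne_zero,
    integral_withDensity_eq_integral_toReal_smul (by fun_prop) (by simp [cauchyPDF])]
  have hr : f (t / (2 * Real.pi)) = (Real.exp (-|t|) : ℂ) := by
    simp only [hf]
    rw [abs_div, abs_of_pos (by positivity : 0 < 2 * Real.pi)]
    push_cast
    congr 1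
    field_simp
  rw [← hr, ← h]
  refine integral_congr_ae (Filter.Eventually.of_forall fun v => ?_)
  simp only [cauchyPDF, ENNReal.toReal_ofReal (cauchyPDF_pos 0 one_ne_zero v).le,
    Complex.real_smul, smul_eq_mul, RCLike.inner_apply, conj_trivial]
  rw [mul_comm]
  congr 2
  have hp : (Real.pi : ℂ) ≠ 0 := by exact_mod_cast Real.pi_ne_zero
  push_cast
  field_simp

/-! ### The averaged eigenvalue product as a Laplace transform -/

/-- The joint law of the entries of an `m × n` matrix with independent Cauchy entries. -/
noncomputable abbrev cauchyPi (m n : ℕ) : Measure (Fin m × Fin n → ℝ) :=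
  Measure.pi fun _ => cauchyMeasure 0 1

theorem IsCauchyMatrix.aemeasurable {Ω : Type*} [MeasurableSpace Ω] {P : Measure Ω} {m n : ℕ}
    {A : Ω → Matrix (Fin m) (Fin n) ℝ} (hA : IsCauchyMatrix P A) :
    AEMeasurable (fun ω (p : Fin m × Fin n) => A ω p.1 p.2) P :=
  aemeasurable_pi_lambda _ fun p => (hA.hasLaw_entry p.1 p.2).aemeasurable

theorem IsCauchyMatrix.map_eq {Ω : Type*} [MeasurableSpace Ω] {P : Measure Ω}
    [IsProbabilityMeasure P] {m n : ℕ}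
    {A : Ω → Matrix (Fin m) (Fin n) ℝ} (hA : IsCauchyMatrix P A) :
    P.map (fun ω (p : Fin m × Fin n) => A ω p.1 p.2) = cauchyPi m n := by
  rw [(iIndepFun_iff_map_fun_eq_pi_map fun p : Fin m × Fin n =>
    (hA.hasLaw_entry p.1 p.2).aemeasurable).1 hA.indep]
  simp_rw [fun p : Fin m × Fin n => (hA.hasLaw_entry p.1 p.2).map_eq]

/-- The quadratic form `|a g|² / (2 m² n²)`. -/
noncomputable def scaledQuadratic (m n : ℕ) (p : (Fin m × Fin n → ℝ) × (Fin n → ℝ)) : ℝ :=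
  (∑ i, (∑ j, p.1 (i, j) * p.2 j) ^ 2) / (2 * ((m : ℝ) ^ 2 * (n : ℝ) ^ 2))

theorem scaledQuadratic_nonneg (m n : ℕ) (p : (Fin m × Fin n → ℝ) × (Fin n → ℝ)) :
    0 ≤ scaledQuadratic m n p := by
  unfold scaledQuadratic
  positivity

theorem continuous_scaledQuadratic (m n : ℕ) : Continuous (scaledQuadratic m n) := by
  unfold scaledQuadratic
  fun_prop

/-- The function `a ↦ ∏ (1 + z λᵢ)^(-1/2)`, with `λᵢ` the rescaled eigenvalues, in terms of the
family of matrix entries. -/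
noncomputable def eigenvalueProd (m n : ℕ) (z : ℂ) (a : Fin m × Fin n → ℝ) : ℂ :=
  ∏ i, (1 + z * (rescaledEigenvalue (Matrix.of fun i j => a (i, j)) i : ℂ)) ^ (-(1 / 2) : ℂ)

theorem eigenvalueProd_eq_integral {m n : ℕ} {z : ℂ} (hz : 0 ≤ z.re) (a : Fin m × Fin n → ℝ) :
    eigenvalueProd m n z a
      = ∫ g, Complex.exp (-z * (scaledQuadratic m n (a, g) : ℂ)) ∂(gaussianPi n) := by
  rw [eigenvalueProd, prod_rescaledEigenvalue_eq_integral _ hz]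
  refine integral_congr_ae (Filter.Eventually.of_forall fun g => ?_)
  simp [scaledQuadratic, Matrix.mulVec, dotProduct, pow_two]

theorem integrable_cexp_neg_mul {α : Type*} [MeasurableSpace α] {μ : Measure α}
    [IsFiniteMeasure μ] {X : α → ℝ} (hX : Measurable X) (h0 : ∀ a, 0 ≤ X a) {z : ℂ}
    (hz : 0 ≤ z.re) : Integrable (fun a => Complex.exp (-z * (X a : ℂ))) μ := by
  refine Integrable.of_bound (C := 1) (by fun_prop) (Filter.Eventually.of_forall fun a => ?_)
  rw [Complex.norm_exp]
  have := h0 a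
  simp
  positivity

/-- The product is a partial integral of a bounded continuous function of `(a, g)`, so Fubini yields
integrability without any proof that eigenvalues depend measurably on the matrix. -/
theorem integrable_eigenvalueProd (m n : ℕ) {z : ℂ} (hz : 0 ≤ z.re) :
    Integrable (eigenvalueProd m n z) (cauchyPi m n) := by
  have := (integrable_cexp_neg_mul (μ := (cauchyPi m n).prod (gaussianPi n))
    (continuous_scaledQuadratic m n).measurable (scaledQuadratic_nonneg m n) hz).integral_prod_left
  simpa only [← eigenvalueProd_eq_integral hz] using this

theorem integral_eigenvalueProd (m n : ℕ) {z : ℂ} (hz : 0 ≤ z.re) :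
    ∫ a, eigenvalueProd m n z a ∂(cauchyPi m n)
      = complexMGF (scaledQuadratic m n) ((cauchyPi m n).prod (gaussianPi n)) (-z) := by
  rw [complexMGF, integral_prod _ (integrable_cexp_neg_mul
    (continuous_scaledQuadratic m n).measurable (scaledQuadratic_nonneg m n) hz)]
  simp_rw [eigenvalueProd_eq_integral hz]

/-- For `X ≥ 0` and `t < 0` the integrand `exp (t X)` is at most 1. This makes the complex moment
generating function holomorphic on the open left half-plane. -/
theorem Iio_subset_interior_integrableExpSet {α : Type*} [MeasurableSpace α] {μ : Measure α}
    [IsFiniteMeasure μ] {X : α → ℝ} (hX : Measurable X) (h0 : ∀ a, 0 ≤ X a) :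
    Set.Iio 0 ⊆ interior (integrableExpSet X μ) := by
  refine interior_maximal (fun t ht => ?_) isOpen_Iio
  refine Integrable.of_bound (C := 1) (by fun_prop) (Filter.Eventually.of_forall fun a => ?_)
  rw [Real.norm_eq_abs, Real.abs_exp, Real.exp_le_one_iff]
  exact mul_nonpos_of_nonpos_of_nonneg (le_of_lt ht) (h0 a)

theorem differentiableOn_complexMGF_comp_neg {α : Type*} [MeasurableSpace α] {μ : Measure α}
    [IsFiniteMeasure μ] {X : α → ℝ} (hX : Measurable X) (h0 : ∀ a, 0 ≤ X a) {s : Set ℂ}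
    {φ : ℂ → ℂ} (hφ : DifferentiableOn ℂ φ s) (hs : ∀ z ∈ s, 0 < (φ z).re) :
    DifferentiableOn ℂ (fun z => complexMGF X μ (-φ z)) s := by
  refine (differentiableOn_complexMGF (X := X) (μ := μ)).comp hφ.fun_neg fun z hz => ?_
  refine Iio_subset_interior_integrableExpSet hX h0 ?_
  simpa using hs z hz

/-- The principal root halves an argument already below `π/2` in absolute value, so its cosine stays
positive. -/
theorem re_cpow_half_pos {z : ℂ} (hz : 0 < z.re) : 0 < (z ^ (1 / 2 : ℂ)).re := by
  have hz0 : z ≠ 0 := by rintro rfl; simp at hz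
  rw [Complex.cpow_def_of_ne_zero hz0, Complex.exp_re]
  refine mul_pos (Real.exp_pos _) (Real.cos_pos_of_mem_Ioo ?_)
  have h1 : (Complex.log z * (1 / 2)).im = z.arg / 2 := by
    rw [mul_comm, show (1 / 2 : ℂ) = ((1 / 2 : ℝ) : ℂ) by push_cast; rfl, Complex.im_ofReal_mul,
      Complex.log_im]
    ring
  have h2 := abs_lt.1 (Complex.abs_arg_lt_pi_div_two_iff.2 (Or.inl hz))
  rw [h1]
  constructor <;> linarith [h2.1, h2.2, Real.pi_pos]

/-! ### Exchanging the Cauchy and Gaussian averages -/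

/-- The mean `(|g₁| + ⋯ + |gₙ|) / n`. -/
noncomputable def meanAbs {n : ℕ} (g : Fin n → ℝ) : ℝ := (∑ j, |g j|) / n

theorem meanAbs_nonneg {n : ℕ} (g : Fin n → ℝ) : 0 ≤ meanAbs g := by
  unfold meanAbs
  positivity

theorem continuous_meanAbs {n : ℕ} : Continuous (meanAbs (n := n)) := by
  unfold meanAbs
  fun_prop

/-- The product of the two independent Gaussian means. -/
noncomputable def meanAbsMul (m n : ℕ) (p : (Fin n → ℝ) × (Fin m → ℝ)) : ℝ :=
  meanAbs p.1 * meanAbs p.2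

theorem meanAbsMul_nonneg (m n : ℕ) (p : (Fin n → ℝ) × (Fin m → ℝ)) : 0 ≤ meanAbsMul m n p :=
  mul_nonneg (meanAbs_nonneg _) (meanAbs_nonneg _)

theorem continuous_meanAbsMul (m n : ℕ) : Continuous (meanAbsMul m n) :=
  (continuous_meanAbs.comp continuous_fst).mul (continuous_meanAbs.comp continuous_snd)

/-- The law of the pair of independent standard Gaussian vectors. -/
noncomputable abbrev gaussianPair (m n : ℕ) : Measure ((Fin n → ℝ) × (Fin m → ℝ)) :=
  (gaussianPi n).prod (gaussianPi m)

/-- The bilinear phase `s ∑ hᵢ aᵢⱼ gⱼ`. -/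
noncomputable def bilinearPhase {m n : ℕ} (s : ℝ) (a : Fin m × Fin n → ℝ)
    (p : (Fin n → ℝ) × (Fin m → ℝ)) : ℝ :=
  s * ∑ i, p.2 i * ∑ j, a (i, j) * p.1 j

theorem integral_bilinearPhase_gaussian {m n : ℕ} (s : ℝ) (a : Fin m × Fin n → ℝ)
    (g : Fin n → ℝ) :
    ∫ h, Complex.exp (bilinearPhase s a (g, h) * Complex.I) ∂(gaussianPi m)
      = Complex.exp (-(s ^ 2 / 2) * (∑ i, (∑ j, a (i, j) * g j) ^ 2 : ℝ)) := by
  have h1 : ∀ h : Fin m → ℝ, Complex.exp (bilinearPhase s a (g, h) * Complex.I)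
      = ∏ i, Complex.exp (((s * ∑ j, a (i, j) * g j : ℝ) : ℂ) * (h i : ℂ) * Complex.I) := by
    intro h
    rw [← Complex.exp_sum, bilinearPhase]
    push_cast
    rw [Finset.mul_sum, Finset.sum_mul]
    congr 1
    refine Finset.sum_congr rfl fun i _ => ?_
    ring
  simp_rw [h1]
  rw [integral_fintype_prod_eq_prod (f := fun (i : Fin m) (y : ℝ) =>
    Complex.exp (((s * ∑ j, a (i, j) * g j : ℝ) : ℂ) * (y : ℂ) * Complex.I))]
  simp_rw [← charFun_apply_real, charFun_gaussianReal]
  rw [← Complex.exp_sum]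
  push_cast
  rw [Finset.mul_sum]
  congr 1
  refine Finset.sum_congr rfl fun i _ => ?_
  simp
  ring

theorem integral_bilinearPhase_cauchy {m n : ℕ} {s : ℝ} (hs : 0 ≤ s)
    (p : (Fin n → ℝ) × (Fin m → ℝ)) :
    ∫ a, Complex.exp (bilinearPhase s a p * Complex.I) ∂(cauchyPi m n)
      = Complex.exp (-s * ((∑ j, |p.1 j|) * (∑ i, |p.2 i|) : ℝ)) := by
  have h1 : ∀ a : Fin m × Fin n → ℝ, Complex.exp (bilinearPhase s a p * Complex.I)
      = ∏ q : Fin m × Fin n,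
        Complex.exp (((s * (p.2 q.1 * p.1 q.2) : ℝ) : ℂ) * (a q : ℂ) * Complex.I) := by
    intro a
    rw [← Complex.exp_sum, bilinearPhase, Fintype.sum_prod_type]
    push_cast
    rw [Finset.mul_sum, Finset.sum_mul]
    congr 1
    refine Finset.sum_congr rfl fun i _ => ?_
    rw [Finset.mul_sum, Finset.mul_sum, Finset.sum_mul]
    refine Finset.sum_congr rfl fun j _ => ?_
    ring
  simp_rw [h1]
  rw [integral_fintype_prod_eq_prod (f := fun (q : Fin m × Fin n) (y : ℝ) =>
    Complex.exp (((s * (p.2 q.1 * p.1 q.2) : ℝ) : ℂ) * (y : ℂ) * Complex.I))]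
  simp_rw [← charFun_apply_real, charFun_cauchyMeasure]
  rw [← Complex.ofReal_prod, ← Real.exp_sum, Fintype.sum_prod_type]
  simp_rw [abs_mul, abs_of_nonneg hs]
  push_cast
  congr 1
  rw [mul_comm (∑ x, _) (∑ x, _), Finset.sum_mul_sum, Finset.mul_sum]
  refine Finset.sum_congr rfl fun i _ => ?_
  rw [Finset.mul_sum]
  refine Finset.sum_congr rfl fun j _ => ?_
  ring

/-- Both sides are iterated integrals of the same unimodular function `exp (i s ⟨h, a g⟩)`.
Integrating over `h` produces the quadratic form, integrating over the Cauchy entries produces the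
product of the two sums of absolute values, and Fubini identifies them. -/
theorem complexMGF_scaledQuadratic_sq {m n : ℕ} {t : ℝ} (ht : 0 ≤ t) :
    complexMGF (scaledQuadratic m n) ((cauchyPi m n).prod (gaussianPi n)) (-((t ^ 2 : ℝ) : ℂ))
      = complexMGF (meanAbsMul m n) (gaussianPair m n) (-(t : ℂ)) := by
  -- With this scale, `s²/2` is `t²` times the constant in `scaledQuadratic`, and `s ∑|gⱼ| ∑|hᵢ|` is
  -- `t` times `meanAbsMul`.
  set s : ℝ := t / (m * n) with hs
  have hs0 : 0 ≤ s := by positivity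
  have hb : ∀ x : ℝ, ‖Complex.exp (x * Complex.I)‖ ≤ 1 := fun x => by
    rw [Complex.norm_exp_ofReal_mul_I]
  have hc : Continuous fun q : (Fin m × Fin n → ℝ) × ((Fin n → ℝ) × (Fin m → ℝ)) =>
      Complex.exp (bilinearPhase s q.1 q.2 * Complex.I) := by
    unfold bilinearPhase
    fun_prop
  have hi : Integrable (fun q : (Fin m × Fin n → ℝ) × ((Fin n → ℝ) × (Fin m → ℝ)) =>
      Complex.exp (bilinearPhase s q.1 q.2 * Complex.I))
      ((cauchyPi m n).prod (gaussianPair m n)) :=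
    Integrable.of_bound (C := 1) hc.aestronglyMeasurable (Filter.Eventually.of_forall fun q => hb _)
  have hia : ∀ a, Integrable (fun p => Complex.exp (bilinearPhase s a p * Complex.I))
      (gaussianPair m n) := fun a =>
    Integrable.of_bound (C := 1) (by
      refine Continuous.aestronglyMeasurable ?_
      unfold bilinearPhase
      fun_prop) (Filter.Eventually.of_forall fun q => hb _)
  calc _ = ∫ a, ∫ g, Complex.exp (-((t ^ 2 : ℝ) : ℂ) * (scaledQuadratic m n (a, g) : ℂ))
        ∂(gaussianPi n) ∂(cauchyPi m n) := by
        rw [complexMGF, integral_prod _ (integrable_cexp_neg_mul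
          (continuous_scaledQuadratic m n).measurable (scaledQuadratic_nonneg m n)
          (by rw [Complex.ofReal_re]; positivity))]
    _ = ∫ a, ∫ p, Complex.exp (bilinearPhase s a p * Complex.I)
        ∂(gaussianPair m n) ∂(cauchyPi m n) := by
        refine integral_congr_ae (Filter.Eventually.of_forall fun a => ?_)
        simp only
        rw [integral_prod _ (hia a)]
        refine integral_congr_ae (Filter.Eventually.of_forall fun g => ?_)
        simp only
        rw [integral_bilinearPhase_gaussian]
        congr 1
        rw [scaledQuadratic, hs]
        push_cast
        ring
    _ = ∫ p, ∫ a, Complex.exp (bilinearPhase s a p * Complex.I)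
        ∂(cauchyPi m n) ∂(gaussianPair m n) := integral_integral_swap hi
    _ = _ := by
        rw [complexMGF]
        refine integral_congr_ae (Filter.Eventually.of_forall fun p => ?_)
        simp only
        rw [integral_bilinearPhase_cauchy hs0]
        congr 1
        rw [meanAbsMul, meanAbs, meanAbs, hs]
        push_cast
        ring

/-- Analytic continuation of the identity for `z = t²`; the right side is holomorphic because the
square root maps the half-plane into itself. -/
theorem integral_eigenvalueProd_eq {m n : ℕ} {z : ℂ} (hz : 0 < z.re) :
    ∫ a, eigenvalueProd m n z a ∂(cauchyPi m n)
      = complexMGF (meanAbsMul m n) (gaussianPair m n) (-z ^ (1 / 2 : ℂ)) := by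
  rw [integral_eigenvalueProd m n hz.le]
  refine eqOn_re_pos_of_eq_ofReal (f := fun z => complexMGF (scaledQuadratic m n)
      ((cauchyPi m n).prod (gaussianPi n)) (-z))
    (g := fun z => complexMGF (meanAbsMul m n) (gaussianPair m n) (-z ^ (1 / 2 : ℂ))) ?_ ?_ ?_ hz
  · exact differentiableOn_complexMGF_comp_neg (continuous_scaledQuadratic m n).measurable
      (scaledQuadratic_nonneg m n) differentiableOn_id fun z hz => hz
  · refine differentiableOn_complexMGF_comp_neg (continuous_meanAbsMul m n).measurable
      (meanAbsMul_nonneg m n) ?_ fun z hz => re_cpow_half_pos hz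
    exact differentiableOn_id.cpow_const fun z hz => Or.inl hz
  · intro x hx
    have h1 := complexMGF_scaledQuadratic_sq (m := m) (n := n) (Real.sqrt_nonneg x)
    rw [Real.sq_sqrt hx.le] at h1
    rw [h1, Real.sqrt_eq_rpow, Complex.ofReal_cpow hx.le]
    push_cast
    rfl

/-! ### Transfer to an arbitrary probability space -/

section CauchyMatrix

variable {Ω : Type*} [MeasurableSpace Ω] {P : Measure Ω} [IsProbabilityMeasure P] {m n : ℕ}
  {A : Ω → Matrix (Fin m) (Fin n) ℝ}

theorem IsCauchyMatrix.integrable_eigenvalueProd (hA : IsCauchyMatrix P A) {z : ℂ}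
    (hz : 0 ≤ z.re) :
    Integrable (fun ω => ∏ i, (1 + z * (rescaledEigenvalue (A ω) i : ℂ)) ^ (-(1 / 2) : ℂ)) P := by
  have h := _root_.integrable_eigenvalueProd m n hz
  rw [← hA.map_eq] at h
  exact h.comp_aemeasurable hA.aemeasurable

theorem IsCauchyMatrix.integral_eigenvalueProd (hA : IsCauchyMatrix P A) {z : ℂ}
    (hz : 0 ≤ z.re) :
    ∫ ω, ∏ i, (1 + z * (rescaledEigenvalue (A ω) i : ℂ)) ^ (-(1 / 2) : ℂ) ∂P
      = ∫ a, eigenvalueProd m n z a ∂(cauchyPi m n) := by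
  have h := (_root_.integrable_eigenvalueProd m n hz).aestronglyMeasurable
  rw [← hA.map_eq] at h ⊢
  exact (integral_map hA.aemeasurable h).symm

/-- For the real parameter `t²` the exchange of averages applies directly, including `t = 0`, with
no analytic continuation. -/
theorem IsCauchyMatrix.integral_prod_real (hA : IsCauchyMatrix P A) (t : ℝ) :
    Integrable (fun ω => ∏ i, (1 + t ^ 2 * rescaledEigenvalue (A ω) i) ^ (-(1 / 2) : ℝ)) P ∧
    ∫ ω, ∏ i, (1 + t ^ 2 * rescaledEigenvalue (A ω) i) ^ (-(1 / 2) : ℝ) ∂P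
      = mgf (meanAbsMul m n) (gaussianPair m n) (-|t|) := by
  have hz : 0 ≤ ((t ^ 2 : ℝ) : ℂ).re := by rw [Complex.ofReal_re]; positivity
  have h1 := hA.integrable_eigenvalueProd hz
  have h2 := hA.integral_eigenvalueProd hz
  simp_rw [← ofReal_prod_rescaledEigenvalue _ (sq_nonneg t)] at h1 h2
  refine ⟨h1.re, ?_⟩
  have h3 := complexMGF_scaledQuadratic_sq (m := m) (n := n) (abs_nonneg t)
  rw [sq_abs] at h3
  rw [_root_.integral_eigenvalueProd m n hz, h3, integral_complex_ofReal,
    ← Complex.ofReal_neg, complexMGF_ofReal] at h2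
  exact_mod_cast h2

end CauchyMatrix

/-! ### Concentration of the Gaussian means -/

/-- Mean value inequality on the convex left half-plane, where the derivative of `exp` has norm at
most 1. -/
theorem norm_cexp_sub_cexp_le {u v : ℂ} (hu : u.re ≤ 0) (hv : v.re ≤ 0) :
    ‖Complex.exp u - Complex.exp v‖ ≤ ‖u - v‖ := by
  have := Convex.norm_image_sub_le_of_norm_deriv_le (𝕜 := ℂ) (f := Complex.exp)
    (s := {z | z.re ≤ 0}) (C := 1) (fun x _ => Complex.differentiable_exp x) (fun x hx => by
      rw [Complex.deriv_exp, Complex.norm_exp, Real.exp_le_one_iff]; exact hx)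
    (convex_halfSpace_re_le 0) hv hu
  simpa using this

theorem integrable_abs_gaussianReal : Integrable (fun x : ℝ => |x|) (gaussianReal 0 1) := by
  have := (memLp_id_gaussianReal (μ := 0) (v := 1) 1).integrable le_rfl
  exact this.abs

theorem integral_abs_gaussianReal :
    ∫ x, |x| ∂(gaussianReal 0 1) = Real.sqrt (2 / Real.pi) := by
  rw [integral_gaussianReal_eq_integral_smul one_ne_zero]
  have h1 : ∀ x : ℝ, gaussianPDFReal 0 1 x • |x|
      = (fun y : ℝ => (Real.sqrt (2 * Real.pi))⁻¹ * (y * Real.exp (-(1 / 2) * y ^ 2))) |x| := by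
    intro x
    simp only [gaussianPDFReal, smul_eq_mul, sq_abs]
    rw [mul_assoc, mul_comm |x|]
    congr 2
    · simp
    · simp; ring
  have h2 : ∫ y in Set.Ioi (0 : ℝ), y * Real.exp (-(1 / 2) * y ^ 2) = 1 := by
    have := integral_mul_cexp_neg_mul_sq (b := 1 / 2) (by norm_num)
    apply Complex.ofReal_injective
    rw [← integral_complex_ofReal]
    push_cast
    simpa using this
  simp_rw [h1]
  rw [integral_comp_abs (f := fun y : ℝ =>
    (Real.sqrt (2 * Real.pi))⁻¹ * (y * Real.exp (-(1 / 2) * y ^ 2))), integral_const_mul, h2, mul_one, Real.sqrt_div' _ Real.pi_pos.le,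
    Real.sqrt_mul' _ Real.pi_pos.le]
  have : Real.sqrt 2 * Real.sqrt 2 = 2 := Real.mul_self_sqrt (by norm_num)
  field_simp
  linarith

theorem variance_abs_gaussianReal_le : Var[fun x : ℝ => |x|; gaussianReal 0 1] ≤ 1 := by
  refine (variance_le_expectation_sq (by fun_prop)).trans (le_of_eq ?_)
  have h := variance_id_gaussianReal (μ := 0) (v := 1)
  rw [variance_eq_integral (by fun_prop)] at h
  simpa using h

theorem integrable_meanAbs (n : ℕ) : Integrable (meanAbs (n := n)) (gaussianPi n) := by
  unfold meanAbs
  exact (integrable_finsetSum _ fun j _ =>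
    integrable_comp_eval integrable_abs_gaussianReal).div_const _

theorem integral_meanAbs {n : ℕ} (hn : n ≠ 0) :
    ∫ g, meanAbs g ∂(gaussianPi n) = Real.sqrt (2 / Real.pi) := by
  unfold meanAbs
  have hn' : (n : ℝ) ≠ 0 := by exact_mod_cast hn
  rw [integral_div, integral_finsetSum _ fun j _ =>
    integrable_comp_eval integrable_abs_gaussianReal]
  have h : ∀ j : Fin n, ∫ g : Fin n → ℝ, |g j| ∂(gaussianPi n) = Real.sqrt (2 / Real.pi) := by
    intro j
    rw [← integral_abs_gaussianReal]
    exact integral_comp_eval (μ := fun _ : Fin n => gaussianReal 0 1) (f := fun x : ℝ => |x|)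
      (by fun_prop)
  simp_rw [h]
  simp
  field_simp

theorem variance_meanAbs_le {n : ℕ} (hn : n ≠ 0) :
    Var[meanAbs; gaussianPi n] ≤ 1 / n := by
  have hn' : (0 : ℝ) < n := by positivity
  have h1 := variance_sum_pi (μ := fun _ : Fin n => gaussianReal 0 1) (X := fun _ x => |x|)
    fun _ => (memLp_id_gaussianReal 2).abs
  have h2 : (meanAbs : (Fin n → ℝ) → ℝ)
      = fun g => (1 / (n : ℝ)) * (∑ i, fun ω : Fin n → ℝ => |ω i|) g := by
    ext g
    simp [meanAbs]
    ring
  rw [h2, variance_const_mul, h1, Finset.sum_const, Finset.card_univ, Fintype.card_fin,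
    nsmul_eq_mul]
  calc (1 / (n : ℝ)) ^ 2 * ((n : ℝ) * Var[fun x : ℝ => |x|; gaussianReal 0 1])
      ≤ (1 / (n : ℝ)) ^ 2 * ((n : ℝ) * 1) := by gcongr; exact variance_abs_gaussianReal_le
    _ = 1 / (n : ℝ) := by field_simp

theorem memLp_meanAbs (n : ℕ) : MemLp (meanAbs (n := n)) 2 (gaussianPi n) := by
  have h : MemLp (fun g : Fin n → ℝ => ∑ j, |g j|) 2 (gaussianPi n) :=
    memLp_finsetSum _ fun j _ => by
      have := (memLp_id_gaussianReal (μ := 0) (v := 1) 2).abs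
      exact this.comp_measurePreserving (measurePreserving_eval (fun _ => gaussianReal 0 1) j)
  have := h.const_mul ((n : ℝ)⁻¹)
  refine this.congr_norm (by exact continuous_meanAbs.aestronglyMeasurable) ?_
  refine Filter.Eventually.of_forall fun g => ?_
  simp only [meanAbs]
  rw [div_eq_inv_mul]

theorem integral_abs_meanAbs_sub_le {n : ℕ} (hn : n ≠ 0) :
    ∫ g, |meanAbs g - Real.sqrt (2 / Real.pi)| ∂(gaussianPi n) ≤ 1 / Real.sqrt n := by
  have hs : 0 < Real.sqrt n := Real.sqrt_pos.2 (by positivity)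
  have hsq : Real.sqrt n * Real.sqrt n = n := Real.mul_self_sqrt (by positivity)
  have hv := variance_meanAbs_le hn
  rw [variance_eq_integral continuous_meanAbs.aemeasurable, integral_meanAbs hn] at hv
  have hi2 : Integrable (fun g : Fin n → ℝ => (meanAbs g - Real.sqrt (2 / Real.pi)) ^ 2)
      (gaussianPi n) := ((memLp_meanAbs n).sub (memLp_const _)).integrable_sq
  calc ∫ g, |meanAbs g - Real.sqrt (2 / Real.pi)| ∂(gaussianPi n)
      -- The inequality `|y| ≤ (√n/2) y² + 1/(2√n)` replaces Cauchy–Schwarz; the weight `√n`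
      -- balances the two terms when the variance is at most `1/n`.
      ≤ ∫ g, (Real.sqrt n / 2 * (meanAbs g - Real.sqrt (2 / Real.pi)) ^ 2 + 1 / (2 * Real.sqrt n))
        ∂(gaussianPi n) := by
        refine integral_mono ((integrable_meanAbs n).sub (integrable_const _)).abs
          ((hi2.const_mul _).add (integrable_const _)) fun g => ?_
        simp only
        set y := meanAbs g - Real.sqrt (2 / Real.pi)
        rw [← sub_nonneg, ← sq_abs y]
        have : Real.sqrt n / 2 * |y| ^ 2 + 1 / (2 * Real.sqrt n) - |y|
            = (Real.sqrt n * |y| - 1) ^ 2 / (2 * Real.sqrt n) := by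
          field_simp
          ring
        rw [this]
        positivity
    _ = Real.sqrt n / 2 * (∫ g, (meanAbs g - Real.sqrt (2 / Real.pi)) ^ 2 ∂(gaussianPi n))
        + 1 / (2 * Real.sqrt n) := by
        rw [integral_add (hi2.const_mul _) (integrable_const _), integral_const_mul]
        simp
    _ ≤ Real.sqrt n / 2 * (1 / n) + 1 / (2 * Real.sqrt n) := by gcongr
    _ = 1 / Real.sqrt n := by
        nth_rewrite 2 [← hsq]
        field_simp
        norm_num

theorem integrable_meanAbsMul (m n : ℕ) : Integrable (meanAbsMul m n) (gaussianPair m n) :=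
  (integrable_meanAbs n).mul_prod (integrable_meanAbs m)

theorem sqrt_two_div_pi_mul_self :
    Real.sqrt (2 / Real.pi) * Real.sqrt (2 / Real.pi) = 2 / Real.pi :=
  Real.mul_self_sqrt (by positivity)

theorem integral_meanAbsMul {m n : ℕ} (hm : m ≠ 0) (hn : n ≠ 0) :
    ∫ p, meanAbsMul m n p ∂(gaussianPair m n) = 2 / Real.pi := by
  unfold meanAbsMul
  rw [integral_prod_mul, integral_meanAbs hm, integral_meanAbs hn, sqrt_two_div_pi_mul_self]

/-- With `c = √(2/π)`, write `x y - c² = (x - c) y + c (y - c)` and use independence. Each term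
contributes at most `1/√n`, since `c ≤ 1` and `m ≥ n`. -/
theorem integral_abs_meanAbsMul_sub_le {m n : ℕ} (hn : n ≠ 0) (hmn : n ≤ m) :
    ∫ p, |meanAbsMul m n p - 2 / Real.pi| ∂(gaussianPair m n) ≤ 2 / Real.sqrt n := by
  have hm : m ≠ 0 := by omega
  set c := Real.sqrt (2 / Real.pi) with hc
  have hc0 : 0 ≤ c := Real.sqrt_nonneg _
  have hc1 : c ≤ 1 := by
    rw [hc, Real.sqrt_le_one, div_le_one Real.pi_pos]
    linarith [Real.pi_gt_three]
  have i1 := ((integrable_meanAbs n).sub (integrable_const c)).abs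
  have i2 := ((integrable_meanAbs m).sub (integrable_const c)).abs
  have j1 : Integrable (fun p : (Fin n → ℝ) × (Fin m → ℝ) => |meanAbs p.1 - c| * meanAbs p.2)
    (gaussianPair m n) := i1.mul_prod (integrable_meanAbs m)
  have j2 : Integrable (fun p : (Fin n → ℝ) × (Fin m → ℝ) => c * |meanAbs p.2 - c|)
    (gaussianPair m n) := (integrable_const (μ := gaussianPi n) c).mul_prod i2
  have hsn : 0 < Real.sqrt n := Real.sqrt_pos.2 (by positivity)
  have hsm : Real.sqrt n ≤ Real.sqrt m := Real.sqrt_le_sqrt (by exact_mod_cast hmn)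
  calc ∫ p, |meanAbsMul m n p - 2 / Real.pi| ∂(gaussianPair m n)
      ≤ ∫ p, (|meanAbs p.1 - c| * meanAbs p.2 + c * |meanAbs p.2 - c|) ∂(gaussianPair m n) := by
        refine integral_mono ((integrable_meanAbsMul m n).sub (integrable_const _)).abs
          (j1.add j2) fun p => ?_
        simp only
        have h : meanAbsMul m n p - 2 / Real.pi
            = (meanAbs p.1 - c) * meanAbs p.2 + c * (meanAbs p.2 - c) := by
          rw [meanAbsMul, ← sqrt_two_div_pi_mul_self]
          ring
        rw [h]
        refine (abs_add_le _ _).trans (le_of_eq ?_)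
        rw [abs_mul, abs_mul, abs_of_nonneg (meanAbs_nonneg p.2), abs_of_nonneg hc0]
    _ = (∫ g, |meanAbs g - c| ∂(gaussianPi n)) * c + c * ∫ h, |meanAbs h - c| ∂(gaussianPi m) := by
        rw [integral_add j1 j2, integral_prod_mul (fun g : Fin n → ℝ => |meanAbs g - c|) meanAbs,
          integral_prod_mul (fun _ : Fin n → ℝ => c) (fun h : Fin m → ℝ => |meanAbs h - c|),
          integral_meanAbs hm, ← hc]
        simp
    _ ≤ (1 / Real.sqrt n) * 1 + 1 * (1 / Real.sqrt n) := by
        have a1 := integral_abs_meanAbs_sub_le hn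
        have a2 := (integral_abs_meanAbs_sub_le hm).trans
          (one_div_le_one_div_of_le hsn hsm)
        have b1 : 0 ≤ ∫ h, |meanAbs h - c| ∂(gaussianPi m) := integral_nonneg fun _ => abs_nonneg _
        gcongr
    _ = 2 / Real.sqrt n := by ring

theorem norm_complexMGF_meanAbsMul_sub_le {m n : ℕ} (hn : n ≠ 0) (hmn : n ≤ m) {w : ℂ}
    (hw : 0 ≤ w.re) :
    ‖complexMGF (meanAbsMul m n) (gaussianPair m n) (-w)
      - Complex.exp (-(2 / (Real.pi : ℂ)) * w)‖ ≤ ‖w‖ * (2 / Real.sqrt n) := by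
  have hi := integrable_cexp_neg_mul (μ := gaussianPair m n)
    (continuous_meanAbsMul m n).measurable (meanAbsMul_nonneg m n) hw
  have h1 : complexMGF (meanAbsMul m n) (gaussianPair m n) (-w)
      - Complex.exp (-(2 / (Real.pi : ℂ)) * w)
      = ∫ p, (Complex.exp (-w * (meanAbsMul m n p : ℂ)) - Complex.exp (-(2 / (Real.pi : ℂ)) * w))
        ∂(gaussianPair m n) := by
    rw [integral_sub hi (integrable_const _), complexMGF]
    simp
  rw [h1]
  have habs := ((integrable_meanAbsMul m n).sub (integrable_const (2 / Real.pi))).abs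
  calc _ ≤ ∫ p, ‖w‖ * |meanAbsMul m n p - 2 / Real.pi| ∂(gaussianPair m n) := by
        refine norm_integral_le_of_norm_le (habs.const_mul _)
          (Filter.Eventually.of_forall fun p => ?_)
        have hp := meanAbsMul_nonneg m n p
        have hpi : 0 ≤ 2 / Real.pi := by positivity
        have e1 : -(2 / (Real.pi : ℂ)) * w = -w * ((2 / Real.pi : ℝ) : ℂ) := by
          push_cast; ring
        rw [e1]
        refine (norm_cexp_sub_cexp_le ?_ ?_).trans (le_of_eq ?_)
        · rw [Complex.re_mul_ofReal, Complex.neg_re]; nlinarith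
        · rw [Complex.re_mul_ofReal, Complex.neg_re]; nlinarith
        · rw [← mul_sub, norm_mul, norm_neg, ← Complex.ofReal_sub, Complex.norm_real,
            Real.norm_eq_abs]
    _ ≤ _ := by
        rw [integral_const_mul]
        gcongr
        exact integral_abs_meanAbsMul_sub_le hn hmn

/-! ### Error in the exponent and uniform convergence -/

/-- Jensen's inequality, obtained by integrating the tangent line of the exponential at the mean
`2/π`. -/
theorem exp_le_mgf_meanAbsMul {m n : ℕ} (hm : m ≠ 0) (hn : n ≠ 0) {t : ℝ} (ht : 0 ≤ t) :
    Real.exp (-(2 / Real.pi) * t) ≤ mgf (meanAbsMul m n) (gaussianPair m n) (-t) := by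
  set c := 2 / Real.pi with hc
  have hi : Integrable (fun p => Real.exp (-t * meanAbsMul m n p)) (gaussianPair m n) := by
    have := (integrable_cexp_neg_mul (μ := gaussianPair m n) (z := (t : ℂ))
      (continuous_meanAbsMul m n).measurable (meanAbsMul_nonneg m n) (by simpa using ht)).re
    refine this.congr (Filter.Eventually.of_forall fun p => ?_)
    simp only [← Complex.ofReal_neg, ← Complex.ofReal_mul, ← Complex.ofReal_exp]
    rfl
  have hl : Integrable (fun p => t * (meanAbsMul m n p - c)) (gaussianPair m n) :=
    ((integrable_meanAbsMul m n).sub (integrable_const _)).const_mul _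
  have hlin : Integrable (fun p => Real.exp (-c * t) * (1 - t * (meanAbsMul m n p - c)))
      (gaussianPair m n) :=
    ((integrable_const _).sub hl).const_mul _
  have h1 : ∫ p, Real.exp (-c * t) * (1 - t * (meanAbsMul m n p - c)) ∂(gaussianPair m n)
      = Real.exp (-c * t) := by
    rw [integral_const_mul, integral_sub (integrable_const _) hl, integral_const_mul,
      integral_sub (integrable_meanAbsMul m n) (integrable_const _), integral_meanAbsMul hm hn]
    simp [hc]
  rw [← h1, mgf]
  refine integral_mono hlin hi fun p => ?_
  have : Real.exp (-t * meanAbsMul m n p)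
      = Real.exp (-c * t) * Real.exp (-t * (meanAbsMul m n p - c)) := by
    rw [← Real.exp_add]; ring_nf
  simp only
  rw [this]
  gcongr
  linarith [Real.add_one_le_exp (-t * (meanAbsMul m n p - c))]

/-- The relative error in the exponent of the Gaussian representation. -/
noncomputable def exponentError (m n : ℕ) (t : ℝ) : ℝ :=
  if t = 0 then 0 else
    -(Real.pi / (2 * |t|)) * Real.log (mgf (meanAbsMul m n) (gaussianPair m n) (-|t|)) - 1

theorem mgf_meanAbsMul_eq_exp {m n : ℕ} (hm : m ≠ 0) (hn : n ≠ 0) (t : ℝ) :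
    mgf (meanAbsMul m n) (gaussianPair m n) (-|t|)
      = Real.exp (-(2 / Real.pi) * |t| * (1 + exponentError m n t)) := by
  have hpos := (Real.exp_pos _).trans_le (exp_le_mgf_meanAbsMul hm hn (abs_nonneg t))
  -- At `t = 0` both sides are 1, whatever value the error is given there.
  rcases eq_or_ne t 0 with rfl | ht
  · simp
  have : -(2 / Real.pi) * |t| * (1 + exponentError m n t)
      = Real.log (mgf (meanAbsMul m n) (gaussianPair m n) (-|t|)) := by
    rw [exponentError, if_neg ht]
    have h1 : |t| ≠ 0 := abs_ne_zero.2 ht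
    have h2 := Real.pi_ne_zero
    field_simp
    ring
  rw [this, Real.exp_log hpos]

/-- The error is `-(π / (2|t|)) log (a/b)`, with `a` the expectation and `b` its limit. Jensen gives
`log (a/b) ≥ 0`, and `log x ≤ x - 1` bounds it by `2|t| / (b √n)`; the factor `|t|` cancels, so the
bound stays finite near `t = 0`. -/
theorem abs_exponentError_le {m n : ℕ} (hn : n ≠ 0) (hmn : n ≤ m) (t : ℝ) :
    |exponentError m n t| ≤ Real.pi * Real.exp (2 / Real.pi * |t|) / Real.sqrt n := by
  have hm : m ≠ 0 := by omega
  rcases eq_or_ne t 0 with rfl | ht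
  · simp [exponentError]
    positivity
  have ht' : 0 < |t| := abs_pos.2 ht
  set a := mgf (meanAbsMul m n) (gaussianPair m n) (-|t|) with ha
  set b := Real.exp (-(2 / Real.pi) * |t|) with hb
  have hb0 : 0 < b := Real.exp_pos _
  have ha0 : 0 < a := hb0.trans_le (exp_le_mgf_meanAbsMul hm hn (abs_nonneg t))
  have hba : b ≤ a := exp_le_mgf_meanAbsMul hm hn (abs_nonneg t)
  have hdiff : a - b ≤ |t| * (2 / Real.sqrt n) := by
    have h := norm_complexMGF_meanAbsMul_sub_le hn hmn (w := (|t| : ℝ)) (by simp)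
    have e : complexMGF (meanAbsMul m n) (gaussianPair m n) (-((|t| : ℝ) : ℂ))
        - Complex.exp (-(2 / (Real.pi : ℂ)) * ((|t| : ℝ) : ℂ)) = ((a - b : ℝ) : ℂ) := by
      rw [← Complex.ofReal_neg, complexMGF_ofReal, ha, hb]
      push_cast
      rfl
    rw [e, Complex.norm_real, Complex.norm_real, Real.norm_eq_abs, Real.norm_eq_abs, abs_abs] at h
    exact (le_abs_self _).trans h
  have hlog : Real.log a - Real.log b ≤ |t| * (2 / Real.sqrt n) / b := by
    rw [← Real.log_div ha0.ne' hb0.ne']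
    refine (Real.log_le_sub_one_of_pos (div_pos ha0 hb0)).trans ?_
    rw [div_sub_one hb0.ne']
    gcongr
  have hlog0 : 0 ≤ Real.log a - Real.log b := sub_nonneg.2 (Real.log_le_log hb0 hba)
  have hlb : Real.log b = -(2 / Real.pi) * |t| := Real.log_exp _
  have hr : exponentError m n t = -(Real.pi / (2 * |t|)) * (Real.log a - Real.log b) := by
    rw [exponentError, if_neg ht, hlb]
    have h1 := Real.pi_ne_zero
    field_simp
    ring
  rw [hr, abs_mul, abs_neg, abs_of_nonneg (by positivity), abs_of_nonneg hlog0]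
  calc _ ≤ Real.pi / (2 * |t|) * (|t| * (2 / Real.sqrt n) / b) := by gcongr
    _ = Real.pi * b⁻¹ / Real.sqrt n := by field_simp
    _ = _ := by rw [hb, ← Real.exp_neg]; ring_nf

theorem exponentError_isLittleO {ε : ℝ} (hε : 0 < ε) {K : Set ℝ} (hK : IsCompact K) {δ : ℝ}
    (hδ : 0 < δ) :
    ∃ N : ℕ, ∀ m n : ℕ, N ≤ n → n ≤ m → ∀ t ∈ K,
      |exponentError m n t| ≤ δ * (n : ℝ) ^ (-(1 / 2) + ε) := by
  obtain ⟨T, hT⟩ := hK.isBounded.exists_norm_le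
  set C := Real.pi * Real.exp (2 / Real.pi * T) with hC
  have h1 : Filter.Tendsto (fun n : ℕ => (n : ℝ) ^ ε) Filter.atTop Filter.atTop :=
    (tendsto_rpow_atTop hε).comp tendsto_natCast_atTop_atTop
  -- The bound `C / √n` is improved to `δ n^(-1/2+ε)` once `n^ε` exceeds `C / δ`.
  obtain ⟨N, hN⟩ := Filter.eventually_atTop.1 (h1.eventually_ge_atTop (C / δ))
  refine ⟨max N 1, fun m n hn hmn t ht => ?_⟩
  have hn0 : n ≠ 0 := by have := le_of_max_le_right hn; omega
  have hn' : (0 : ℝ) < n := by positivity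
  have hNn := hN n (le_of_max_le_left hn)
  rw [div_le_iff₀ hδ] at hNn
  have htT : |t| ≤ T := hT t ht
  calc _ ≤ Real.pi * Real.exp (2 / Real.pi * |t|) / Real.sqrt n := abs_exponentError_le hn0 hmn t
    _ ≤ C / Real.sqrt n := by rw [hC]; gcongr
    _ ≤ (n : ℝ) ^ ε * δ / Real.sqrt n := by gcongr
    _ = _ := by
      rw [Real.rpow_add hn', Real.rpow_neg hn'.le, Real.sqrt_eq_rpow]
      field_simp

theorem complexMGF_meanAbsMul_tendsto {K : Set ℂ} (hK : IsCompact K) (hKr : K ⊆ {z | 0 < z.re})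
    {δ : ℝ} (hδ : 0 < δ) :
    ∃ N : ℕ, 1 ≤ N ∧ ∀ m n : ℕ, N ≤ n → n ≤ m → ∀ z ∈ K,
      ‖complexMGF (meanAbsMul m n) (gaussianPair m n) (-z ^ (1 / 2 : ℂ))
        - Complex.exp (-(2 / (Real.pi : ℂ)) * z ^ (1 / 2 : ℂ))‖ < δ := by
  have hc : ContinuousOn (fun z : ℂ => z ^ (1 / 2 : ℂ)) K :=
    continuousOn_id.cpow_const fun z hz => Or.inl (hKr hz)
  obtain ⟨T, hT⟩ := (hK.image_of_continuousOn hc).isBounded.exists_norm_le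
  have h1 : Filter.Tendsto (fun n : ℕ => |T| * (2 / Real.sqrt n)) Filter.atTop (nhds 0) := by
    have : Filter.Tendsto (fun n : ℕ => Real.sqrt n) Filter.atTop Filter.atTop :=
      Real.tendsto_sqrt_atTop.comp tendsto_natCast_atTop_atTop
    simpa using (this.const_div_atTop 2).const_mul |T|
  obtain ⟨N, hN⟩ := Filter.eventually_atTop.1 (h1.eventually_lt_const hδ)
  refine ⟨max N 1, le_max_right _ _, fun m n hn hmn z hz => ?_⟩
  have hn0 : n ≠ 0 := by have := le_of_max_le_right hn; omega
  refine (norm_complexMGF_meanAbsMul_sub_le hn0 hmn (re_cpow_half_pos (hKr hz)).le).trans_lt ?_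
  refine lt_of_le_of_lt ?_ (hN n (le_of_max_le_left hn))
  gcongr
  exact (hT _ ⟨z, hz, rfl⟩).trans (le_abs_self _)

/-! ### Counting measures of point sets -/

/-- The counting measure of a set `s`, as a measure on the ambient space. -/
noncomputable def pointMeasure {S : Type*} [MeasurableSpace S] (s : Set S) : Measure S :=
  (Measure.count : Measure s).map Subtype.val

section PointMeasure

variable {S : Type*} [MeasurableSpace S]

theorem pointMeasure_apply (s : Set S) {B : Set S} (hB : MeasurableSet B) :
    pointMeasure s B = ((s ∩ B).encard : ENNReal) := by
  rw [pointMeasure, Measure.map_apply measurable_subtype_coe hB,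
    Measure.count_apply (measurable_subtype_coe hB)]
  congr 1
  rw [← Subtype.val_injective.encard_image, Subtype.image_preimage_coe]

theorem hasSum_integral_pointMeasure [MeasurableSingletonClass S] {s : Set S} (hs : s.Countable) {f : S → ℂ}
    (hf : Measurable f) (hi : Integrable f (pointMeasure s)) :
    HasSum (fun x : s => f x) (∫ x, f x ∂(pointMeasure s)) := by
  have : Countable s := hs.to_subtype
  have h1 : Integrable (fun x : s => f x) Measure.count :=
    hi.comp_measurable measurable_subtype_coe
  have h2 : Summable (fun x : s => f x) := (integrable_count_iff.1 h1).of_norm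
  rw [pointMeasure, integral_map measurable_subtype_coe.aemeasurable hf.aestronglyMeasurable,
    integral_countable h1]
  simpa [Measure.real] using h2.hasSum

theorem cexp_integral_simpleFunc_pointMeasure (f : SimpleFunc S ℂ) {s : Set S}
    (hi : Integrable f (pointMeasure s)) :
    Complex.exp (∫ x, f x ∂(pointMeasure s)) = ∏ i : Fin f.range.card,
      Complex.exp ((((s ∩ f ⁻¹' {(f.range.equivFin.symm i : ℂ)}).encard : ENNReal).toReal : ℂ)
        * (f.range.equivFin.symm i : ℂ)) := by
  rw [SimpleFunc.integral_eq_sum f hi, ← Finset.sum_coe_sort,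
    ← f.range.equivFin.symm.sum_comp, Complex.exp_sum]
  refine Finset.prod_congr rfl fun i _ => ?_
  rw [Measure.real, pointMeasure_apply _ (f.measurableSet_fiber _), Complex.real_smul]

end PointMeasure

/-! ### Laplace functional of a Poisson process -/

theorem lintegral_natCast_poissonMeasure (r : NNReal) :
    ∫⁻ k : ℕ, (k : ENNReal) ∂(poissonMeasure r) = r := by
  have hone : ∑' k : ℕ, ENNReal.ofReal (Real.exp (-r) * r ^ k / k.factorial) = 1 := by
    have h := measure_univ (μ := poissonMeasure r)
    rw [poissonMeasure, Measure.sum_apply _ MeasurableSet.univ] at h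
    simpa using h
  rw [poissonMeasure, lintegral_sum_measure]
  simp only [lintegral_smul_measure, lintegral_dirac, smul_eq_mul]
  rw [tsum_eq_zero_add' ENNReal.summable]
  simp only [Nat.cast_zero, mul_zero, zero_add]
  have h : ∀ k : ℕ, ENNReal.ofReal (Real.exp (-r) * r ^ (k + 1) / (k + 1).factorial)
      * ((k + 1 : ℕ) : ENNReal)
      = r * ENNReal.ofReal (Real.exp (-r) * r ^ k / k.factorial) := by
    intro k
    rw [← ENNReal.ofReal_natCast (k + 1), ← ENNReal.ofReal_mul (by positivity),
      ← ENNReal.ofReal_coe_nnreal (p := r), ← ENNReal.ofReal_mul (by positivity)]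
    congr 1
    rw [Nat.factorial_succ]
    push_cast
    field_simp
    ring
  simp_rw [h]
  rw [ENNReal.tsum_mul_left, hone, mul_one]

theorem integral_cexp_mul_poissonMeasure (r : NNReal) (c : ℂ) :
    ∫ k : ℕ, Complex.exp (k * c) ∂(poissonMeasure r)
      = Complex.exp (r * (Complex.exp c - 1)) := by
  rw [integral_poissonMeasure r]
  calc ∑' k : ℕ, (Real.exp (-r) * r ^ k / k.factorial : ℝ) • Complex.exp (k * c)
      = ∑' k : ℕ, (Real.exp (-r) : ℂ) * ((r * Complex.exp c) ^ k / k.factorial) := by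
        congr with k
        rw [Complex.real_smul]
        push_cast
        rw [mul_pow, ← Complex.exp_nat_mul]
        ring
    _ = (Real.exp (-r) : ℂ) * Complex.exp (r * Complex.exp c) := by
        rw [tsum_mul_left, (NormedSpace.expSeries_div_hasSum_exp (r * Complex.exp c)).tsum_eq,
          Complex.exp_eq_exp_ℂ]
    _ = _ := by
        rw [Complex.ofReal_exp, ← Complex.exp_add]
        push_cast
        ring_nf

theorem norm_cexp_sub_one_le {u : ℂ} (hu : u.re ≤ 0) : ‖Complex.exp u - 1‖ ≤ ‖u‖ := by
  simpa using norm_cexp_sub_cexp_le hu (v := 0) le_rfl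

theorem MeasureTheory.Integrable.cexp_sub_one {S : Type*} [MeasurableSpace S] {ν : Measure S}
    {φ : S → ℂ} (hφ : Integrable φ ν) (hre : ∀ x, (φ x).re ≤ 0) :
    Integrable (fun x => Complex.exp (φ x) - 1) ν :=
  hφ.mono ((Complex.continuous_exp.comp_aestronglyMeasurable hφ.aestronglyMeasurable).sub
    aestronglyMeasurable_const) (Filter.Eventually.of_forall fun x => norm_cexp_sub_one_le (hre x))

/-- Integrability is not needed because the integral of a non-integrable function is 0 by
convention; bounds on the random integrals thus hold for every `ω`. -/
theorem re_integral_nonpos {S : Type*} [MeasurableSpace S] {ν : Measure S}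
    {φ : S → ℂ} (hre : ∀ x, (φ x).re ≤ 0) : (∫ x, φ x ∂ν).re ≤ 0 := by
  by_cases hφ : Integrable φ ν
  · have h := integral_re hφ
    simp only [RCLike.re_to_complex] at h
    rw [← h]
    exact integral_nonpos hre
  · simp [integral_undef hφ]

namespace IsPoissonPointProcess

variable {S Ω : Type*} [MeasurableSpace S] [MeasurableSpace Ω]
  {ν : Measure S} {P : Measure Ω} {X : Ω → Set S}

theorem measurable_pointMeasure (hX : IsPoissonPointProcess ν P X) :
    Measurable fun ω => pointMeasure (X ω) := by
  refine Measure.measurable_of_measurable_coe _ fun B hB => ?_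
  simp_rw [pointMeasure_apply _ hB]
  exact (measurable_of_countable (fun k : ℕ∞ => (k : ENNReal))).comp (hX.measurable_count B hB)

theorem integral_cexp_count (hX : IsPoissonPointProcess ν P X) {B : Set S} (hB : MeasurableSet B)
    (hν : ν B ≠ ⊤) (c : ℂ) :
    ∫ ω, Complex.exp ((((X ω ∩ B).encard : ENNReal).toReal : ℂ) * c) ∂P
      = Complex.exp (ν.real B * (Complex.exp c - 1)) := by
  have h := (hX.hasLaw_count B hB hν).integral_comp
    (f := fun k : ℕ∞ => Complex.exp (((k : ENNReal).toReal : ℂ) * c))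
    (measurable_of_countable _).aestronglyMeasurable
  rw [Function.comp_def, integral_map (measurable_of_countable _).aemeasurable
    (measurable_of_countable _).aestronglyMeasurable] at h
  rw [h]
  have hr : ((ν B).toNNReal : ℂ) = (ν.real B : ℂ) := rfl
  simpa [hr] using integral_cexp_mul_poissonMeasure (ν B).toNNReal c

variable [IsProbabilityMeasure P]

/-- The intensity of the process is `ν`. -/
theorem bind_pointMeasure (hX : IsPoissonPointProcess ν P X) :
    P.bind (fun ω => pointMeasure (X ω)) = ν := by
  ext B hB
  rw [Measure.bind_apply hB hX.measurable_pointMeasure.aemeasurable]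
  simp_rw [pointMeasure_apply _ hB]
  by_cases hν : ν B = ⊤
  · rw [hν, lintegral_congr_ae (g := fun _ => ⊤)]
    · simp
    · filter_upwards [hX.count_eq_top B hB hν] with ω hω
      simp [hω]
  · rw [(hX.hasLaw_count B hB hν).lintegral_comp (f := fun k : ℕ∞ => (k : ENNReal))
      (measurable_of_countable _).aemeasurable,
      lintegral_map (measurable_of_countable _) (measurable_of_countable _)]
    simp [lintegral_natCast_poissonMeasure, hν]

/-- Campbell's formula: the expected sum of `‖φ‖` over the points is `∫ ‖φ‖ dν`, which is finite, so
the sum is almost surely finite. -/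
theorem ae_integrable (hX : IsPoissonPointProcess ν P X) {φ : S → ℂ} (hm : Measurable φ)
    (hφ : Integrable φ ν) : ∀ᵐ ω ∂P, Integrable φ (pointMeasure (X ω)) := by
  have h1 : ∫⁻ x, ‖φ x‖ₑ ∂(P.bind (fun ω => pointMeasure (X ω))) < ⊤ := by
    rw [hX.bind_pointMeasure]
    exact hφ.hasFiniteIntegral
  rw [Measure.lintegral_bind hX.measurable_pointMeasure.aemeasurable
    hm.enorm.aemeasurable] at h1
  have h2 := ae_lt_top ((Measure.measurable_lintegral hm.enorm).comp hX.measurable_pointMeasure)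
    h1.ne
  filter_upwards [h2] with ω hω
  exact ⟨hm.aestronglyMeasurable, hω⟩

/-- The fibres of `f` are disjoint, so their counts are independent and the expectation factors into
Poisson generating functions. -/
theorem integral_cexp_simpleFunc (hX : IsPoissonPointProcess ν P X) (f : SimpleFunc S ℂ)
    (hi : Integrable f ν) (hre : ∀ x, (f x).re ≤ 0) :
    AEStronglyMeasurable (fun ω => Complex.exp (∫ x, f x ∂(pointMeasure (X ω)))) P ∧
    ∫ ω, Complex.exp (∫ x, f x ∂(pointMeasure (X ω))) ∂P
      = Complex.exp (∫ x, (Complex.exp (f x) - 1) ∂ν) := by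
  set y : Fin f.range.card → ℂ := fun i => (f.range.equivFin.symm i : ℂ) with hy
  set B : Fin f.range.card → Set S := fun i => f ⁻¹' {y i} with hB
  have hBm : ∀ i, MeasurableSet (B i) := fun i => f.measurableSet_fiber _
  set F : Fin f.range.card → ℕ∞ → ℂ := fun i k => Complex.exp (((k : ENNReal).toReal : ℂ) * y i)
    with hF
  have hFm : ∀ i, Measurable (F i) := fun i => measurable_of_countable _
  have hae : (fun ω => Complex.exp (∫ x, f x ∂(pointMeasure (X ω))))
      =ᵐ[P] fun ω => ∏ i, F i ((X ω ∩ B i).encard) := by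
    filter_upwards [hX.ae_integrable f.measurable hi] with ω hω
    exact cexp_integral_simpleFunc_pointMeasure f hω
  have hdisj : Pairwise fun i j => Disjoint (B i) (B j) := by
    intro i j hij
    refine Disjoint.preimage _ (Set.disjoint_singleton.2 fun h => hij ?_)
    exact f.range.equivFin.symm.injective (Subtype.ext h)
  have hmeas : ∀ i, Measurable fun ω => (X ω ∩ B i).encard := fun i =>
    hX.measurable_count _ (hBm i)
  refine ⟨AEStronglyMeasurable.congr (Measurable.aestronglyMeasurable
    (Finset.measurable_fun_prod _ fun i _ => (hFm i).comp (hmeas i))) hae.symm, ?_⟩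
  rw [integral_congr_ae hae, (hX.indep _ B hBm hdisj).integral_fun_prod_comp (f := F)
    (fun i => (hmeas i).aemeasurable) fun i => (hFm i).aestronglyMeasurable]
  have hfac : ∀ i, ∫ ω, F i ((X ω ∩ B i).encard) ∂P
      = Complex.exp (ν.real (B i) * (Complex.exp (y i) - 1)) := by
    intro i
    -- The fibre over 0 may have infinite measure, where the Poisson formula is unavailable, but its
    -- factor is 1 on both sides.
    by_cases h0 : y i = 0
    · simp [hF, h0]
    · exact hX.integral_cexp_count (hBm i) (f.measure_preimage_lt_top_of_integrable hi h0).ne _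
  simp_rw [hfac]
  rw [← Complex.exp_sum]
  congr 1
  have hmi : Integrable (f.map fun c => Complex.exp c - 1) ν := hi.cexp_sub_one hre
  have h1 : ∫ x, (Complex.exp (f x) - 1) ∂ν
      = ∑ c ∈ f.range, ν.real (f ⁻¹' {c}) • (Complex.exp c - 1) := by
    rw [← SimpleFunc.map_integral f (fun c => Complex.exp c - 1) hi (by simp),
      SimpleFunc.integral_eq_integral _ hmi]
    rfl
  rw [h1, ← Finset.sum_coe_sort f.range, ← f.range.equivFin.symm.sum_comp]
  simp [hB, hy]

/-- The Laplace functional of a Poisson point process. -/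
theorem integral_cexp_integral (hX : IsPoissonPointProcess ν P X) {φ : S → ℂ}
    (hm : Measurable φ) (hi : Integrable φ ν) (hre : ∀ x, (φ x).re ≤ 0) :
    Integrable (fun ω => Complex.exp (∫ x, φ x ∂(pointMeasure (X ω)))) P ∧
    ∫ ω, Complex.exp (∫ x, φ x ∂(pointMeasure (X ω))) ∂P
      = Complex.exp (∫ x, (Complex.exp (φ x) - 1) ∂ν) := by
  have h0 : (0 : ℂ) ∈ {z : ℂ | z.re ≤ 0} := by simp
  -- Approximating inside the closed left half-plane keeps all the exponentials bounded by 1, and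
  -- starting from the value 0 gives the dominating function `2 ‖φ‖`.
  set f : ℕ → SimpleFunc S ℂ := SimpleFunc.approxOn φ hm {z : ℂ | z.re ≤ 0} 0 h0 with hf
  have hfre : ∀ k x, (f k x).re ≤ 0 := fun k x => SimpleFunc.approxOn_mem hm h0 k x
  have hfn : ∀ k x, ‖f k x‖ ≤ 2 * ‖φ x‖ := fun k x => by
    rw [two_mul]; exact SimpleFunc.norm_approxOn_zero_le hm h0 x k
  have hft : ∀ x, Filter.Tendsto (fun k => f k x) Filter.atTop (nhds (φ x)) := fun x =>
    SimpleFunc.tendsto_approxOn hm h0 (subset_closure (hre x))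
  have hfi : ∀ k, Integrable (f k) ν := fun k =>
    (hi.norm.const_mul 2).mono' (f k).aestronglyMeasurable
      (Filter.Eventually.of_forall fun x => hfn k x)
  have hlim : ∀ᵐ ω ∂P, Filter.Tendsto
      (fun k => Complex.exp (∫ x, f k x ∂(pointMeasure (X ω)))) Filter.atTop
      (nhds (Complex.exp (∫ x, φ x ∂(pointMeasure (X ω))))) := by
    filter_upwards [hX.ae_integrable hm hi] with ω hω
    refine (Complex.continuous_exp.tendsto _).comp ?_
    exact tendsto_integral_of_dominated_convergence (fun x => 2 * ‖φ x‖)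
      (fun k => (f k).aestronglyMeasurable) (hω.norm.const_mul 2)
      (fun k => Filter.Eventually.of_forall fun x => hfn k x)
      (Filter.Eventually.of_forall hft)
  have hbd : ∀ (ψ : S → ℂ), (∀ x, (ψ x).re ≤ 0) → ∀ ω,
      ‖Complex.exp (∫ x, ψ x ∂(pointMeasure (X ω)))‖ ≤ 1 := fun ψ hψ ω => by
    rw [Complex.norm_exp, Real.exp_le_one_iff]
    exact re_integral_nonpos hψ
  have hsm : ∀ k, AEStronglyMeasurable
      (fun ω => Complex.exp (∫ x, f k x ∂(pointMeasure (X ω)))) P := fun k =>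
    (hX.integral_cexp_simpleFunc (f k) (hfi k) (hfre k)).1
  refine ⟨Integrable.of_bound (C := 1) (aestronglyMeasurable_of_tendsto_ae _ hsm hlim)
    (Filter.Eventually.of_forall (hbd φ hre)), ?_⟩
  have l1 := tendsto_integral_of_dominated_convergence (fun _ => (1 : ℝ)) hsm
    (integrable_const _) (fun k => Filter.Eventually.of_forall (hbd (f k) (hfre k))) hlim
  have l2 : Filter.Tendsto (fun k => Complex.exp (∫ x, (Complex.exp (f k x) - 1) ∂ν))
      Filter.atTop (nhds (Complex.exp (∫ x, (Complex.exp (φ x) - 1) ∂ν))) := by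
    refine (Complex.continuous_exp.tendsto _).comp ?_
    refine tendsto_integral_of_dominated_convergence (fun x => 2 * ‖φ x‖)
      (fun k => ((hfi k).cexp_sub_one (hfre k)).aestronglyMeasurable) (hi.norm.const_mul 2)
      (fun k => Filter.Eventually.of_forall fun x =>
        (norm_cexp_sub_one_le (hfre k x)).trans (hfn k x))
      (Filter.Eventually.of_forall fun x => ?_)
    exact (((Complex.continuous_exp.tendsto _).comp (hft x)).sub_const 1)
  simp_rw [fun k => (hX.integral_cexp_simpleFunc (f k) (hfi k) (hfre k)).2] at l1
  exact tendsto_nhds_unique l1 l2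

/-- The expected number of points in the complement is its intensity, namely 0. -/
theorem ae_subset (hX : IsPoissonPointProcess ν P X) {B : Set S} (hB : MeasurableSet B)
    (hν : ν Bᶜ = 0) : ∀ᵐ ω ∂P, X ω ⊆ B := by
  have h1 := hX.bind_pointMeasure ▸ hν
  rw [Measure.bind_apply hB.compl hX.measurable_pointMeasure.aemeasurable,
    lintegral_eq_zero_iff (f := fun ω => pointMeasure (X ω) Bᶜ)
      ((Measure.measurable_coe hB.compl).comp hX.measurable_pointMeasure)] at h1
  filter_upwards [h1] with ω hω
  simp only [pointMeasure_apply _ hB.compl, Pi.zero_apply] at hω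
  have : (X ω ∩ Bᶜ).encard = 0 := by simpa using hω
  rw [Set.encard_eq_zero, ← Set.sdiff_eq, Set.sdiff_eq_empty] at this
  exact this

end IsPoissonPointProcess

/-! ### The intensity `1 / (π x^(3/2))` and the integral of the factors -/

theorem measurable_cauchyDensity :
    Measurable fun x : ℝ => ENNReal.ofReal (1 / (Real.pi * x ^ (3 / 2 : ℝ))) := by
  fun_prop

theorem ae_smul_cauchyDensity (f : ℝ → ℂ) :
    (fun x : ℝ => (ENNReal.ofReal (1 / (Real.pi * x ^ (3 / 2 : ℝ)))).toReal • f x)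
      =ᵐ[volume.restrict (Set.Ioi 0)]
      fun x : ℝ => ((1 / (Real.pi * x ^ (3 / 2 : ℝ)) : ℝ) : ℂ) * f x := by
  filter_upwards [ae_restrict_mem measurableSet_Ioi] with x hx
  have hx' : 0 < x := hx
  rw [ENNReal.toReal_ofReal (by positivity), Complex.real_smul]

theorem integrable_cauchyIntensity_iff {f : ℝ → ℂ} :
    Integrable f cauchyIntensity ↔
      IntegrableOn (fun x : ℝ => ((1 / (Real.pi * x ^ (3 / 2 : ℝ)) : ℝ) : ℂ) * f x)
        (Set.Ioi 0) := by
  rw [cauchyIntensity, integrable_withDensity_iff_integrable_smul' measurable_cauchyDensity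
    (Filter.Eventually.of_forall fun x => ENNReal.ofReal_lt_top),
    integrable_congr (ae_smul_cauchyDensity f)]
  rfl

theorem integral_cauchyIntensity (f : ℝ → ℂ) :
    ∫ x, f x ∂cauchyIntensity
      = ∫ x in Set.Ioi (0 : ℝ), ((1 / (Real.pi * x ^ (3 / 2 : ℝ)) : ℝ) : ℂ) * f x := by
  rw [cauchyIntensity, integral_withDensity_eq_integral_toReal_smul measurable_cauchyDensity
    (Filter.Eventually.of_forall fun x => ENNReal.ofReal_lt_top),
    integral_congr_ae (ae_smul_cauchyDensity f)]

theorem cauchyIntensity_Ioi_compl : cauchyIntensity (Set.Ioi 0)ᶜ = 0 := by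
  refine withDensity_absolutelyContinuous _ _ ?_
  rw [Measure.restrict_apply measurableSet_Ioi.compl, Set.compl_inter_self, measure_empty]

/-- The logarithm of `(1 + z x) ^ (-1/2)` for `x > 0`, extended by zero. -/
noncomputable def logFactor (z : ℂ) : ℝ → ℂ :=
  (Set.Ioi 0).indicator fun x => -(1 / 2) * Complex.log (1 + z * x)

section LogFactor

variable {z : ℂ}

theorem one_le_norm_one_add_mul (hz : 0 ≤ z.re) {x : ℝ} (hx : 0 ≤ x) : 1 ≤ ‖1 + z * x‖ := by
  refine le_trans ?_ (Complex.re_le_norm _)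
  simp
  positivity

theorem one_add_mul_ne_zero (hz : 0 ≤ z.re) {x : ℝ} (hx : 0 ≤ x) : 1 + z * x ≠ 0 := by
  have := one_add_mul_re_pos hz hx
  rintro h
  simp [h] at this

theorem measurable_logFactor (z : ℂ) : Measurable (logFactor z) :=
  Measurable.indicator (by fun_prop) measurableSet_Ioi

theorem logFactor_re_nonpos (hz : 0 ≤ z.re) (x : ℝ) : (logFactor z x).re ≤ 0 := by
  unfold logFactor
  by_cases hx : x ∈ Set.Ioi (0 : ℝ)
  · rw [Set.indicator_of_mem hx]
    have h := Real.log_nonneg (one_le_norm_one_add_mul hz (le_of_lt hx))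
    rw [show (-(1 / 2) : ℂ) = ((-(1 / 2) : ℝ) : ℂ) by push_cast; rfl, Complex.re_ofReal_mul,
      Complex.log_re]
    linarith
  · simp [Set.indicator_of_notMem hx]

theorem cexp_logFactor (hz : 0 ≤ z.re) {x : ℝ} (hx : 0 < x) :
    Complex.exp (logFactor z x) = (1 + z * x) ^ (-(1 / 2) : ℂ) := by
  rw [logFactor, Set.indicator_of_mem (Set.mem_Ioi.2 hx),
    Complex.cpow_def_of_ne_zero (one_add_mul_ne_zero hz hx.le), mul_comm]

theorem norm_log_one_add_le_norm {w : ℂ} (hw : 0 ≤ w.re) : ‖Complex.log (1 + w)‖ ≤ ‖w‖ := by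
  have hne : ∀ u : ℂ, u ∈ {u : ℂ | 1 ≤ u.re} → u ∈ Complex.slitPlane := fun u hu =>
    Or.inl (zero_lt_one.trans_le hu)
  have := Convex.norm_image_sub_le_of_norm_deriv_le (𝕜 := ℂ) (f := Complex.log)
    (s := {u | 1 ≤ u.re}) (C := 1) (x := 1) (y := 1 + w)
    (fun u hu => (Complex.hasDerivAt_log (hne u hu)).differentiableAt)
    (fun u hu => by
      rw [(Complex.hasDerivAt_log (hne u hu)).deriv, norm_inv]
      exact inv_le_one_of_one_le₀ (le_trans hu (Complex.re_le_norm u)))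
    (convex_halfSpace_re_ge 1) (by simp) (by simpa using hw)
  simpa using this

/-- The exponent `1/4` is one choice below `1/2`, so that the bound is integrable at infinity
against `x^(-3/2)`. The factor 4 comes from `log y ≤ 4 y^(1/4)`, the summand 2 from bounding the
argument. -/
theorem norm_log_one_add_mul_le (hz : 0 ≤ z.re) {x : ℝ} (hx : 1 ≤ x) :
    ‖Complex.log (1 + z * x)‖ ≤ (4 * (1 + ‖z‖) ^ (1 / 4 : ℝ) + 2) * x ^ (1 / 4 : ℝ) := by
  have hx0 : 0 ≤ x := by linarith
  have h1 := one_le_norm_one_add_mul hz hx0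
  have harg : |(1 + z * x).arg| ≤ 2 := by
    have := (Complex.abs_arg_lt_pi_div_two_iff (z := 1 + z * x)).2
      (Or.inl (one_add_mul_re_pos hz hx0))
    linarith [Real.pi_lt_four]
  have hnorm : ‖1 + z * x‖ ≤ (1 + ‖z‖) * x := by
    refine (norm_add_le _ _).trans ?_
    rw [norm_mul, Complex.norm_real, Real.norm_of_nonneg hx0, norm_one]
    linarith
  have hlog : Real.log ‖1 + z * x‖ ≤ 4 * ((1 + ‖z‖) ^ (1 / 4 : ℝ) * x ^ (1 / 4 : ℝ)) := by
    refine (Real.log_le_rpow_div (norm_nonneg _) (by norm_num : (0 : ℝ) < 1 / 4)).trans ?_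
    rw [← Real.mul_rpow (by positivity) hx0]
    have := Real.rpow_le_rpow (norm_nonneg _) hnorm (by norm_num : (0 : ℝ) ≤ 1 / 4)
    linarith
  have hxp : 1 ≤ x ^ (1 / 4 : ℝ) := Real.one_le_rpow hx (by norm_num)
  refine (Complex.norm_le_abs_re_add_abs_im _).trans ?_
  rw [Complex.log_re, Complex.log_im, abs_of_nonneg (Real.log_nonneg h1)]
  nlinarith

/-- Near 0 the logarithm is `O(x)`, leaving `x^(-1/2)`; beyond 1 it is `O(x^(1/4))`, leaving
`x^(-5/4)`. -/
theorem integrable_logFactor (hz : 0 ≤ z.re) : Integrable (logFactor z) cauchyIntensity := by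
  rw [integrable_cauchyIntensity_iff, ← Set.Ioc_union_Ioi_eq_Ioi zero_le_one]
  have hm : Measurable fun x : ℝ =>
      ((1 / (Real.pi * x ^ (3 / 2 : ℝ)) : ℝ) : ℂ) * logFactor z x :=
    Measurable.mul (by fun_prop) (measurable_logFactor z)
  have hb : ∀ x : ℝ, 0 < x → ‖((1 / (Real.pi * x ^ (3 / 2 : ℝ)) : ℝ) : ℂ) * logFactor z x‖
      ≤ x ^ (-(3 / 2) : ℝ) * ‖Complex.log (1 + z * x)‖ := by
    intro x hx
    rw [logFactor, Set.indicator_of_mem (Set.mem_Ioi.2 hx), norm_mul, norm_mul, Complex.norm_real,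
      Real.norm_of_nonneg (by positivity), Real.rpow_neg hx.le]
    have h1 : 1 / (Real.pi * x ^ (3 / 2 : ℝ)) ≤ (x ^ (3 / 2 : ℝ))⁻¹ := by
      rw [one_div]
      refine inv_anti₀ (by positivity) (le_mul_of_one_le_left (by positivity) ?_)
      linarith [Real.pi_gt_three]
    have h2 : ‖(-(1 / 2) : ℂ)‖ ≤ 1 := by norm_num
    calc _ ≤ (x ^ (3 / 2 : ℝ))⁻¹ * (1 * ‖Complex.log (1 + z * x)‖) := by gcongr
      _ = _ := by rw [one_mul]
  refine IntegrableOn.union ?_ ?_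
  · have hi : IntegrableOn (fun x : ℝ => ‖z‖ * x ^ (-(1 / 2) : ℝ)) (Set.Ioc 0 1) :=
      ((intervalIntegrable_iff_integrableOn_Ioc_of_le zero_le_one).1
        (intervalIntegral.intervalIntegrable_rpow' (by norm_num))).const_mul _
    refine Integrable.mono' hi hm.aestronglyMeasurable ?_
    filter_upwards [ae_restrict_mem measurableSet_Ioc] with x hx
    refine (hb x hx.1).trans ?_
    have h1 := norm_log_one_add_le_norm (w := z * x) (by
      rw [Complex.re_mul_ofReal]; exact mul_nonneg hz hx.1.le)
    rw [norm_mul, Complex.norm_real, Real.norm_of_nonneg hx.1.le] at h1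
    have hx0 := hx.1
    calc _ ≤ x ^ (-(3 / 2) : ℝ) * (‖z‖ * x) := by gcongr
      _ = ‖z‖ * (x ^ (-(3 / 2) : ℝ) * x ^ (1 : ℝ)) := by rw [Real.rpow_one]; ring
      _ = _ := by rw [← Real.rpow_add hx0]; norm_num
  · have hi : IntegrableOn (fun x : ℝ => (4 * (1 + ‖z‖) ^ (1 / 4 : ℝ) + 2) * x ^ (-(5 / 4) : ℝ))
        (Set.Ioi 1) :=
      (integrableOn_Ioi_rpow_of_lt (by norm_num) zero_lt_one).const_mul _
    refine Integrable.mono' hi hm.aestronglyMeasurable ?_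
    filter_upwards [ae_restrict_mem measurableSet_Ioi] with x hx
    have hx1 : 1 < x := hx
    have hx0 : 0 < x := by linarith
    refine (hb x hx0).trans ?_
    calc _ ≤ x ^ (-(3 / 2) : ℝ) * ((4 * (1 + ‖z‖) ^ (1 / 4 : ℝ) + 2) * x ^ (1 / 4 : ℝ)) := by
          gcongr
          exact norm_log_one_add_mul_le hz hx1.le
      _ = (4 * (1 + ‖z‖) ^ (1 / 4 : ℝ) + 2) * (x ^ (-(3 / 2) : ℝ) * x ^ (1 / 4 : ℝ)) := by ring
      _ = _ := by rw [← Real.rpow_add hx0]; norm_num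

theorem cpow_half_sq (w : ℂ) : (w ^ (1 / 2 : ℂ)) ^ 2 = w := by
  rw [← Complex.cpow_nat_mul]
  simp

/-- An antiderivative of `((1 + z x)^(-1/2) - 1) / (π x^(3/2))`. -/
noncomputable def halfPowerPrimitive (z : ℂ) (x : ℝ) : ℂ :=
  -(2 / (Real.pi : ℂ)) * z * (Real.sqrt x : ℂ) / (1 + (1 + z * x) ^ (1 / 2 : ℂ))

theorem one_add_cpow_half_ne_zero (hz : 0 ≤ z.re) {x : ℝ} (hx : 0 ≤ x) :
    1 + (1 + z * x) ^ (1 / 2 : ℂ) ≠ 0 := by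
  have := re_cpow_half_pos (one_add_mul_re_pos hz hx)
  intro h
  have h' := congrArg Complex.re h
  rw [Complex.add_re, Complex.one_re, Complex.zero_re] at h'
  linarith

/-- With `s = (1 + z x)^(1/2)`, the primitive equals `(2/π)(1 - s)/√x` for `x > 0`. The rationalised
form, with denominator `1 + s`, removes the singularity at 0, where its value is 0. -/
theorem continuousWithinAt_halfPowerPrimitive (hz : 0 ≤ z.re) :
    ContinuousWithinAt (halfPowerPrimitive z) (Set.Ici 0) 0 := by
  refine ContinuousAt.continuousWithinAt ?_
  unfold halfPowerPrimitive
  have h1 : ContinuousAt (fun x : ℝ => (1 + z * (x : ℂ)) ^ (1 / 2 : ℂ)) 0 := by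
    exact ContinuousAt.cpow (by fun_prop) continuousAt_const (by simp)
  refine ContinuousAt.div (by fun_prop) (continuousAt_const.add h1) ?_
  exact one_add_cpow_half_ne_zero hz le_rfl

theorem hasDerivAt_halfPowerPrimitive (hz : 0 ≤ z.re) {x : ℝ} (hx : 0 < x) :
    HasDerivAt (halfPowerPrimitive z)
      (((1 / (Real.pi * x ^ (3 / 2 : ℝ)) : ℝ) : ℂ) * ((1 + z * x) ^ (-(1 / 2) : ℂ) - 1)) x := by
  set s : ℂ := (1 + z * x) ^ (1 / 2 : ℂ) with hs
  set r : ℂ := (Real.sqrt x : ℂ) with hr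
  have hs2 : s ^ 2 = 1 + z * x := cpow_half_sq _
  have hrx : r ^ 2 = x := by rw [hr, ← Complex.ofReal_pow, Real.sq_sqrt hx.le]
  have hs1 : 1 + s ≠ 0 := one_add_cpow_half_ne_zero hz hx.le
  have hs0 : s ≠ 0 := by
    intro h
    rw [h] at hs2
    exact one_add_mul_ne_zero hz hx.le (by rw [← hs2]; simp)
  have hr0 : r ≠ 0 := by
    rw [hr]
    have := (Real.sqrt_pos.2 hx).ne'
    exact_mod_cast this
  have hpi : (Real.pi : ℂ) ≠ 0 := by exact_mod_cast Real.pi_ne_zero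
  have hneg : (1 + z * x) ^ (-(1 / 2) : ℂ) = s⁻¹ := by rw [Complex.cpow_neg]
  have hpow : ((x ^ (3 / 2 : ℝ) : ℝ) : ℂ) = r ^ 3 := by
    rw [hr, ← Complex.ofReal_pow, Real.sqrt_eq_rpow, ← Real.rpow_natCast, ← Real.rpow_mul hx.le]
    norm_num
  have d1 : HasDerivAt (fun y : ℝ => (Real.sqrt y : ℂ)) ((1 / (2 * Real.sqrt x) : ℝ) : ℂ) x :=
    (Real.hasDerivAt_sqrt hx.ne').ofReal_comp
  have d0 : HasDerivAt (fun y : ℝ => 1 + z * (y : ℂ)) z x := by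
    simpa using ((Complex.ofRealCLM.hasDerivAt (x := x)).const_mul z).const_add 1
  have d2 : HasDerivAt (fun y : ℝ => (1 + z * (y : ℂ)) ^ (1 / 2 : ℂ))
      (1 / 2 * s⁻¹ * z) x := by
    have h := (Complex.hasStrictDerivAt_cpow_const (x := 1 + z * (x : ℂ)) (c := 1 / 2)
      (Or.inl (one_add_mul_re_pos hz hx.le))).hasDerivAt.comp x d0
    have e : (1 / 2 - 1 : ℂ) = -(1 / 2) := by norm_num
    rw [e, hneg] at h
    exact h
  have d3 := (d1.const_mul (-(2 / (Real.pi : ℂ)) * z)).div (d2.const_add 1) hs1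
  refine d3.congr_deriv ?_
  rw [← hs, hneg]
  push_cast
  rw [hpow, ← hr]
  -- After clearing denominators, this is the only relation between `s`, `r` and `z` that is needed.
  have hz' : z * r ^ 2 = s ^ 2 - 1 := by rw [hrx, hs2]; ring
  field_simp
  linear_combination (z * r ^ 2 - s - 1) * hz'

/-- Factoring `1 + z x = x (1/x + z)` extracts `√x` from the root; it cancels against the numerator
and leaves `-(2/π) z / √z`. -/
theorem tendsto_halfPowerPrimitive (hz : 0 < z.re) :
    Filter.Tendsto (halfPowerPrimitive z) Filter.atTop
      (nhds (-(2 / (Real.pi : ℂ)) * z ^ (1 / 2 : ℂ))) := by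
  have hz0 : z ≠ 0 := by rintro rfl; simp at hz
  have hw0 : z ^ (1 / 2 : ℂ) ≠ 0 := by
    intro h
    have := cpow_half_sq z
    rw [h] at this
    exact hz0 (by rw [← this]; simp)
  have hi : Filter.Tendsto (fun x : ℝ => ((x⁻¹ : ℝ) : ℂ)) Filter.atTop (nhds 0) := by
    rw [← Complex.ofReal_zero]
    exact (Complex.continuous_ofReal.tendsto 0).comp tendsto_inv_atTop_zero
  have hr : Filter.Tendsto (fun x : ℝ => (((Real.sqrt x)⁻¹ : ℝ) : ℂ)) Filter.atTop (nhds 0) := by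
    rw [← Complex.ofReal_zero]
    exact (Complex.continuous_ofReal.tendsto 0).comp
      (tendsto_inv_atTop_zero.comp Real.tendsto_sqrt_atTop)
  have hc : Filter.Tendsto (fun x : ℝ => (((x⁻¹ : ℝ) : ℂ) + z) ^ (1 / 2 : ℂ)) Filter.atTop
      (nhds (z ^ (1 / 2 : ℂ))) := by
    have h1 : ContinuousAt (fun u : ℂ => u ^ (1 / 2 : ℂ)) z :=
      continuousAt_id.cpow continuousAt_const (Or.inl hz)
    have h2 : Filter.Tendsto (fun x : ℝ => ((x⁻¹ : ℝ) : ℂ) + z) Filter.atTop (nhds z) := by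
      simpa using hi.add_const z
    exact h1.tendsto.comp h2
  have hd := (tendsto_const_nhds (x := -(2 / (Real.pi : ℂ)) * z)).div (hr.add hc)
    (by simpa using hw0)
  have hlim : -(2 / (Real.pi : ℂ)) * z / (0 + z ^ (1 / 2 : ℂ))
      = -(2 / (Real.pi : ℂ)) * z ^ (1 / 2 : ℂ) := by
    rw [zero_add, div_eq_iff hw0, mul_assoc, ← pow_two, cpow_half_sq]
  rw [hlim] at hd
  refine hd.congr' ?_
  filter_upwards [Filter.eventually_gt_atTop 0] with x hx
  have hr0 : (Real.sqrt x : ℂ) ≠ 0 := by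
    have := (Real.sqrt_pos.2 hx).ne'
    exact_mod_cast this
  have hx0 : (x : ℂ) ≠ 0 := by exact_mod_cast hx.ne'
  have e : 1 + z * x = (x : ℂ) * (((x⁻¹ : ℝ) : ℂ) + z) := by
    push_cast
    field_simp
  have e2 : (x : ℂ) ^ (1 / 2 : ℂ) = (Real.sqrt x : ℂ) := by
    rw [Real.sqrt_eq_rpow, Complex.ofReal_cpow hx.le]
    push_cast
    rfl
  rw [halfPowerPrimitive, e, ofReal_mul_cpow hx, e2]
  simp only [Pi.div_apply, Complex.ofReal_inv (Real.sqrt x)]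
  have e3 : 1 + (Real.sqrt x : ℂ) * (((x⁻¹ : ℝ) : ℂ) + z) ^ (1 / 2 : ℂ)
      = (Real.sqrt x : ℂ) * ((Real.sqrt x : ℂ)⁻¹ + (((x⁻¹ : ℝ) : ℂ) + z) ^ (1 / 2 : ℂ)) := by
    rw [mul_add, mul_inv_cancel₀ hr0]
  rw [e3, mul_comm (-(2 / (Real.pi : ℂ)) * z) (Real.sqrt x : ℂ), mul_div_mul_left _ _ hr0]

theorem integral_cexp_logFactor_sub_one (hz : 0 < z.re) :
    ∫ x, (Complex.exp (logFactor z x) - 1) ∂cauchyIntensity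
      = -(2 / (Real.pi : ℂ)) * z ^ (1 / 2 : ℂ) := by
  have hi := (integrable_logFactor hz.le).cexp_sub_one (logFactor_re_nonpos hz.le)
  rw [integrable_cauchyIntensity_iff] at hi
  have hcongr : Set.EqOn (fun x : ℝ => ((1 / (Real.pi * x ^ (3 / 2 : ℝ)) : ℝ) : ℂ)
      * (Complex.exp (logFactor z x) - 1))
      (fun x : ℝ => ((1 / (Real.pi * x ^ (3 / 2 : ℝ)) : ℝ) : ℂ)
      * ((1 + z * x) ^ (-(1 / 2) : ℂ) - 1)) (Set.Ioi 0) := fun x hx => by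
    simp only [cexp_logFactor hz.le (Set.mem_Ioi.1 hx)]
  rw [integral_cauchyIntensity, setIntegral_congr_fun measurableSet_Ioi hcongr,
    integral_Ioi_of_hasDerivAt_of_tendsto (continuousWithinAt_halfPowerPrimitive hz.le)
      (fun x hx => hasDerivAt_halfPowerPrimitive hz.le hx)
      (hi.congr_fun hcongr measurableSet_Ioi) (tendsto_halfPowerPrimitive hz)]
  simp [halfPowerPrimitive]

end LogFactor

/-- Almost surely all points are positive and the logarithms are absolutely summable over them;
exponentiating gives unconditional convergence of the product, and the Laplace functional gives its
mean. -/
theorem IsPoissonPointProcess.tprod_cauchyIntensity {Ω : Type*} [MeasurableSpace Ω] {Q : Measure Ω}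
    [IsProbabilityMeasure Q] {X : Ω → Set ℝ} (hX : IsPoissonPointProcess cauchyIntensity Q X)
    {z : ℂ} (hz : 0 < z.re) :
    (∀ᵐ ω ∂Q, Multipliable (fun x : X ω => (1 + z * ((x : ℝ) : ℂ)) ^ (-(1 / 2) : ℂ))) ∧
      Integrable (fun ω => ∏' x : X ω, (1 + z * ((x : ℝ) : ℂ)) ^ (-(1 / 2) : ℂ)) Q ∧
      Complex.exp (-(2 / (Real.pi : ℂ)) * z ^ (1 / 2 : ℂ)) =
        ∫ ω, ∏' x : X ω, (1 + z * ((x : ℝ) : ℂ)) ^ (-(1 / 2) : ℂ) ∂Q := by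
  have hm := measurable_logFactor z
  have hi := integrable_logFactor hz.le
  have hprod : ∀ᵐ ω ∂Q, HasProd (fun x : X ω => (1 + z * ((x : ℝ) : ℂ)) ^ (-(1 / 2) : ℂ))
      (Complex.exp (∫ x, logFactor z x ∂(pointMeasure (X ω)))) := by
    filter_upwards [hX.ae_integrable hm hi,
      hX.ae_subset measurableSet_Ioi cauchyIntensity_Ioi_compl] with ω h1 h2
    have h := (hasSum_integral_pointMeasure (hX.countable ω) hm h1).cexp
    have e : Complex.exp ∘ (fun x : X ω => logFactor z x)
        = fun x : X ω => (1 + z * ((x : ℝ) : ℂ)) ^ (-(1 / 2) : ℂ) :=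
      funext fun x => cexp_logFactor hz.le (h2 x.2)
    rwa [e] at h
  have hL := hX.integral_cexp_integral hm hi (logFactor_re_nonpos hz.le)
  have hae : (fun ω => Complex.exp (∫ x, logFactor z x ∂(pointMeasure (X ω))))
      =ᵐ[Q] fun ω => ∏' x : X ω, (1 + z * ((x : ℝ) : ℂ)) ^ (-(1 / 2) : ℂ) := by
    filter_upwards [hprod] with ω h using h.tprod_eq.symm
  refine ⟨?_, hL.1.congr hae, ?_⟩
  · filter_upwards [hprod] with ω h using h.multipliable
  · rw [← integral_congr_ae hae, hL.2, integral_cexp_logFactor_sub_one hz]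
-- Assembly of the theorem
theorem theorem1p1
    {Ω : ℕ → ℕ → Type*} [∀ m n, MeasurableSpace (Ω m n)]
    (P : ∀ m n, Measure (Ω m n)) [∀ m n, IsProbabilityMeasure (P m n)]
    (A : ∀ m n, Ω m n → Matrix (Fin m) (Fin n) ℝ)
    (hA : ∀ m n, IsCauchyMatrix (P m n) (A m n)) :
    -- the two expressions for the expectation agree (and the expectation exists)
    (∀ m n : ℕ, 1 ≤ n → n ≤ m → ∀ z : ℂ, 0 < z.re →
      Integrable (fun ω => detInvSqrt (A m n ω) z) (P m n) ∧
      Integrable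
        (fun ω => ∏ i, (1 + z * (rescaledEigenvalue (A m n ω) i : ℂ)) ^ (-(1 / 2) : ℂ))
        (P m n) ∧
      ∫ ω, detInvSqrt (A m n ω) z ∂(P m n) =
        ∫ ω, ∏ i, (1 + z * (rescaledEigenvalue (A m n ω) i : ℂ)) ^ (-(1 / 2) : ℂ) ∂(P m n)) ∧
    -- convergence as `n → ∞`, `m ≥ n`, uniformly on compact subsets of the right half-plane
    (∀ K : Set ℂ, IsCompact K → K ⊆ {z | 0 < z.re} → ∀ δ : ℝ, 0 < δ →
      ∃ N : ℕ, ∀ m n : ℕ, N ≤ n → n ≤ m → ∀ z ∈ K,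
        ‖(∫ ω, detInvSqrt (A m n ω) z ∂(P m n))
          - Complex.exp (-(2 / (Real.pi : ℂ)) * z ^ (1 / 2 : ℂ))‖ < δ) ∧
    -- the limit is the corresponding expectation for the Poisson process
    (∀ (Ω' : Type*) [MeasurableSpace Ω'] (Q : Measure Ω') [IsProbabilityMeasure Q]
      (X : Ω' → Set ℝ), IsPoissonPointProcess cauchyIntensity Q X → ∀ z : ℂ, 0 < z.re →
      (∀ᵐ ω ∂Q, Multipliable (fun x : X ω => (1 + z * ((x : ℝ) : ℂ)) ^ (-(1 / 2) : ℂ))) ∧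
      Integrable (fun ω => ∏' x : X ω, (1 + z * ((x : ℝ) : ℂ)) ^ (-(1 / 2) : ℂ)) Q ∧
      Complex.exp (-(2 / (Real.pi : ℂ)) * z ^ (1 / 2 : ℂ)) =
        ∫ ω, ∏' x : X ω, (1 + z * ((x : ℝ) : ℂ)) ^ (-(1 / 2) : ℂ) ∂Q) ∧
    -- rate of convergence for `z = t ^ 2`, uniformly for `t` in compact sets
    (∃ r : ℕ → ℕ → ℝ → ℝ,
      (∀ m n : ℕ, 1 ≤ n → n ≤ m → ∀ t : ℝ,
        Integrable (fun ω => (1 + t ^ 2 • scaledGram (A m n ω)).det ^ (-(1 / 2) : ℝ)) (P m n) ∧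
        ∫ ω, (1 + t ^ 2 • scaledGram (A m n ω)).det ^ (-(1 / 2) : ℝ) ∂(P m n) =
          ∫ ω, ∏ i, (1 + t ^ 2 * rescaledEigenvalue (A m n ω) i) ^ (-(1 / 2) : ℝ) ∂(P m n) ∧
        ∫ ω, (1 + t ^ 2 • scaledGram (A m n ω)).det ^ (-(1 / 2) : ℝ) ∂(P m n) =
          Real.exp (-(2 / Real.pi) * |t| * (1 + r m n t))) ∧
      ∀ ε : ℝ, 0 < ε → ∀ K : Set ℝ, IsCompact K → ∀ δ : ℝ, 0 < δ →
        ∃ N : ℕ, ∀ m n : ℕ, N ≤ n → n ≤ m → ∀ t ∈ K,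
          |r m n t| ≤ δ * (n : ℝ) ^ (-(1 / 2) + ε)) := by
  refine ⟨fun m n hn hmn z hz => ?_, fun K hK hKr δ hδ => ?_, ?_, exponentError,
    fun m n hn hmn t => ?_, fun ε hε K hK δ hδ => exponentError_isLittleO hε hK hδ⟩
  · have hi := (hA m n).integrable_eigenvalueProd hz.le
    have he : (fun ω => detInvSqrt (A m n ω) z)
        = fun ω => ∏ i, (1 + z * (rescaledEigenvalue (A m n ω) i : ℂ)) ^ (-(1 / 2) : ℂ) :=
      funext fun ω => detInvSqrt_eq_prod (by omega) (by omega) _ hz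
    rw [he]
    exact ⟨hi, hi, rfl⟩
  · obtain ⟨N, hN1, hN⟩ := complexMGF_meanAbsMul_tendsto hK hKr hδ
    refine ⟨N, fun m n hn hmn z hz => ?_⟩
    have hz' : 0 < z.re := hKr hz
    have he : ∫ ω, detInvSqrt (A m n ω) z ∂(P m n)
        = complexMGF (meanAbsMul m n) (gaussianPair m n) (-z ^ (1 / 2 : ℂ)) := by
      simp_rw [fun ω => detInvSqrt_eq_prod (m := m) (n := n) (by omega) (by omega) (A m n ω) hz']
      rw [(hA m n).integral_eigenvalueProd hz'.le, integral_eigenvalueProd_eq hz']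
    rw [he]
    exact hN m n hn hmn z hz
  · intro Ω' _ Q _ X hX z hz
    exact hX.tprod_cauchyIntensity hz
  · have hr := (hA m n).integral_prod_real t
    have he : (fun ω => (1 + t ^ 2 • scaledGram (A m n ω)).det ^ (-(1 / 2) : ℝ))
        = fun ω => ∏ i, (1 + t ^ 2 * rescaledEigenvalue (A m n ω) i) ^ (-(1 / 2) : ℝ) :=
      funext fun ω => det_rpow_eq_prod (by omega) (by omega) _ (sq_nonneg t)
    rw [he]
    exact ⟨hr.1, rfl, hr.2.trans (mgf_meanAbsMul_eq_exp (by omega) (by omega) t)⟩
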